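/- All graphs are finite, simple and undirected. A graph $H$ is a reconstruction of $G$ if $V(G)=V(H)$ and $G-v\cong H-v$ for every vertex $v$. A function $\mu$ of graphs is called reconstructible if $\mu(G)=\mu(H)$ whenever $G$ and $H$ are graphs on at least three vertices that are reconstructions of each other. For $A\subseteq E(G)$ let $k(A)$ be the number of connected components of $(V(G),A)$, let $r(A)=|V(G)|-k(A)$, let $V(A)$ be the set of vertices covered by $A$, and let $k_{\mathrm{cov}}(A)$ be the number of connected components of $(V(A),A)$. Define $$U(G;\bar x,y)=\sum_{A\subseteq E(G)}y^{|A|-r(A)}\prod_{D}x_{|V(D)|},$$ where $D$ runs over the connected components of $(V(G),A)$, and the universal edge elimination polynomial $$\xi(G;x,y,z)=\sum_{(A,B)}x^{k(A\cup B)-k_{\mathrm{cov}}(B)}\,y^{|A|+|B|-k_{\mathrm{cov}}(B)}\,z^{k_{\mathrm{cov}}(B)},$$ where $(A,B)$ runs over the pairs of subsets of $E(G)$ with $V(A)\cap V(B)=\emptyset$. **Theorem.** The polynomials $U$ and $\xi$ (over $\mathbb Z$) are reconstructible, and so is every evaluation of either of them at elements of a commutative ring. In particular the following hold. 1. For every graph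 $G$ there is a polynomial $P(G;x,y)\in\mathbb Z[x,y]$, the bivariate chromatic polynomial, such that for all integers $0\le q\le p$, $P(G;p,q)$ is the number of maps $f:V(G)\to\{1,\dots,p\}$ for which no two adjacent vertices $u,v$ satisfy $f(u)=f(v)\le q$. It equals $\xi(G;x,-1,x-y)$ and is reconstructible. 2. Stanley's chromatic symmetric function $X_G=\sum_{\kappa}\prod_{v\in V(G)}x_{\kappa(v)}$, a formal power series in countably many variables (sum over all proper colourings $\kappa$ of $G$ with countably many colours), is the evaluation of $U(G;\bar x,y)$ at $x_i=(-1)^{i-1}p_i$, $y=-1$, where $p_i=\sum_j x_j^i$ is the $i$-th power sum, and it is reconstructible. 3. The polychromate $\sum_{\pi}y^{e(\pi)}\prod_{B\in\pi}x_{|B|}$ (sum over all partitions $\pi$ of $V(G)$ into nonempty blocks, $e(\pi)$ being the number of edges with both ends in the same block) is the image of $U(G;\bar x,y)$ under a $\mathbb Z$-linear map that does not depend on $G$, and it is reconstructible. -/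

import Mathlib

universe u w

/-- `H` is a reconstruction of `G`: the two graphs have the same vertex set, and for every vertex
`v` the vertex-deleted subgraphs `G - v` and `H - v` are isomorphic. -/
def IsReconstruction {V : Type u} (G H : SimpleGraph V) : Prop :=
  ∀ v : V, Nonempty (G.induce {w | w ≠ v} ≃g H.induce {w | w ≠ v})

/-- A function `μ` on finite simple graphs is reconstructible if it takes the same value on any two
graphs, with at least three vertices, that are reconstructions of each other. -/
def IsReconstructible {α : Type w} (μ : ∀ (V : Type u) [Fintype V], SimpleGraph V → α) : Prop :=
  ∀ (V : Type u) [Fintype V], 3 ≤ Fintype.card V →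
    ∀ G H : SimpleGraph V, IsReconstruction G H → μ V G = μ V H

/-- The variables `x₁, x₂, …` and `y` (the variable `x 0` never occurs below). -/
inductive UVar : Type
  | x (i : ℕ)
  | y

section

variable {V : Type u} [Fintype V]

open Classical in
/-- The edge set of a finite simple graph as a finset. -/
noncomputable def edges (G : SimpleGraph V) : Finset (Sym2 V) := G.edgeFinset

/-- The spanning graph `(V, A)`. -/
def spanning (A : Finset (Sym2 V)) : SimpleGraph V := SimpleGraph.fromEdgeSet (A : Set (Sym2 V))

/-- `k(A)`: the number of connected components of `(V, A)`. -/
noncomputable def numComp (A : Finset (Sym2 V)) : ℕ := Nat.card (spanning A).ConnectedComponent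

/-- `r(A) = |V| - k(A)`; no truncation occurs, since `k(A) ≤ |V|`. -/
noncomputable def edgeRank (A : Finset (Sym2 V)) : ℕ := Fintype.card V - numComp A

open Classical in
/-- The `U`-polynomial `∑_{A ⊆ E} y^(|A| - r(A)) ∏_D x_{|V(D)|}`, where `D` runs over the connected
components of `(V, A)`; no truncation occurs, since `r(A) ≤ |A|`. -/
noncomputable def UPoly (G : SimpleGraph V) : MvPolynomial UVar ℤ :=
  ∑ A ∈ (edges G).powerset,
    MvPolynomial.X UVar.y ^ (A.card - edgeRank A) *
      ∏ D : (spanning A).ConnectedComponent, MvPolynomial.X (UVar.x (Nat.card D.supp))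

/-- `V(A)`: the set of vertices covered by the edges in `A`. -/
def covered (A : Finset (Sym2 V)) : Set V := {v | ∃ e ∈ A, v ∈ e}

/-- `k_cov(B)`: the number of connected components of the graph `(V(B), B)`. -/
noncomputable def numCovComp (B : Finset (Sym2 V)) : ℕ :=
  Nat.card ((spanning B).induce (covered B)).ConnectedComponent

open Classical in
/-- The universal edge elimination polynomial
`ξ(G; x, y, z) = ∑ x^(k(A ⊔ B) - k_cov(B)) y^(|A| + |B| - k_cov(B)) z^(k_cov(B))`, the sum being
over all pairs of edge sets `A`, `B` that cover disjoint sets of vertices. The variables `x, y, z`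
are `X 0, X 1, X 2`. No truncation occurs: every component of `(V(B), B)` is a component of
`(V, A ∪ B)` and contains an edge of `B`. -/
noncomputable def xiPoly (G : SimpleGraph V) : MvPolynomial (Fin 3) ℤ :=
  ∑ p ∈ ((edges G).powerset ×ˢ (edges G).powerset).filter
      (fun p => Disjoint (covered p.1) (covered p.2)),
    MvPolynomial.X 0 ^ (numComp (p.1 ∪ p.2) - numCovComp p.2) *
      MvPolynomial.X 1 ^ (p.1.card + p.2.card - numCovComp p.2) *
      MvPolynomial.X 2 ^ numCovComp p.2

/-- The generalized proper colourings of `G` with `p` colours of which the first `q` are proper: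
adjacent vertices may share a colour only if that colour is not proper. -/
def GenColoring (G : SimpleGraph V) (p q : ℕ) : Type u :=
  {f : V → Fin p // ∀ u v, G.Adj u v → (f u : ℕ) < q → (f v : ℕ) < q → f u ≠ f v}

/-- `P(x, y)` is the bivariate polynomial that counts generalized proper colourings of `G`. -/
def IsBivariateChromatic (G : SimpleGraph V) (P : MvPolynomial (Fin 2) ℤ) : Prop :=
  ∀ p q : ℕ, q ≤ p → MvPolynomial.eval ![(p : ℤ), (q : ℤ)] P = (Nat.card (GenColoring G p q) : ℤ)

/-- The bivariate chromatic polynomial `P(G; x, y)` (variables `x = X 0` and `y = X 1`): the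
polynomial that counts generalized proper colourings. -/
noncomputable def bivariateChromatic (G : SimpleGraph V) : MvPolynomial (Fin 2) ℤ :=
  Classical.epsilon (IsBivariateChromatic G)

/-- Stanley's chromatic symmetric function `X_G = ∑_κ ∏_v x_{κ(v)}`, over all proper colourings
`κ : V → ℕ`, as a formal power series in `x_0, x_1, …`: the coefficient of a monomial `m` is the
number of proper colourings `κ` with `∏_v x_{κ(v)} = m`. -/
noncomputable def chromaticSymm (G : SimpleGraph V) : MvPowerSeries ℕ ℤ :=
  fun m => (Nat.card {κ : G.Coloring ℕ // ∑ v, Finsupp.single (κ v) 1 = m} : ℤ)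

open Classical in
/-- The polychromate `∑_π y^(e(π)) ∏_{B ∈ π} x_{|B|}`, over all partitions `π` of the vertex set
into nonempty blocks, where `e(π)` is the number of edges with both ends in the same block. -/
noncomputable def polychromate (G : SimpleGraph V) : MvPolynomial UVar ℤ :=
  ∑ π : Finpartition (Finset.univ : Finset V),
    MvPolynomial.X UVar.y ^ ((edges G).filter (fun e => ∃ B ∈ π.parts, ∀ v ∈ e, v ∈ B)).card *
      ∏ B ∈ π.parts, MvPolynomial.X (UVar.x B.card)

end

open Classical in
/-- The power sum `p_i = ∑_j x_j^i` (for `i ≥ 1`) as a formal power series in `x_0, x_1, …`. -/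
noncomputable def powerSum (i : ℕ) : MvPowerSeries ℕ ℤ :=
  fun m => if ∃ j, m = Finsupp.single j i then 1 else 0

/-- The substitution `x_i = (-1)^(i-1) p_i`, `y = -1`. -/
noncomputable def stanleySubst : UVar → MvPowerSeries ℕ ℤ
  | UVar.x i => (-1) ^ (i + 1) * powerSum i
  | UVar.y => -1

section

variable {V : Type u} [Fintype V]

open Classical Finset

set_option linter.unusedSectionVars false

/-! Everything follows from the reconstructibility of `U`; the other invariants are images of `U`
under maps that do not depend on the graph.

For `U`, clear the rank exponent by multiplying with y^|V|, so that an edge set A weighs y^|A| ∏ (y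
x_|B|) over its components B. This weight is multiplicative up to singleton factors. Since component
sizes sum to |V|, |V| times the total weight is a sum over vertex sets S of |S| times the weight of
edge sets connecting S, times the weight of edge sets on the complement
(`sum_card_mul_connectedWeight`). For 0 < |S| < |V| such sums over complementary pairs are
reconstructible: inclusion-exclusion over the sets X containing both members
(`sum_compl_eq_inclusion_exclusion`) reduces them to Kelly's lemma (`IsReconstruction.sum_proper`).

Only S = V is left. With n = |V| and C the generating function of connected spanning edge sets, y^n
(U(G) - U(H)) = y x_n (C(G) - C(H)). Substituting x_i = y^(i-1) turns `U` into (1+y)^|E|, which is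
reconstructible by counting edges, and leaves C unchanged. Hence C(G) = C(H), and then U(G) = U(H).

The polynomial ξ is a substitution instance of `U`: B is a union of nontrivial components of A ∪ B,
so a pair (A, B) is an edge set with some nontrivial components marked (`xiPoly_eq_sum`). The two
colouring invariants come from inclusion-exclusion over monochromatic edges. The polychromate comes
from expanding y^e(π) in powers of y - 1 and summing over the partitions coarser than the components
of an edge set, a sum that depends only on the component sizes. -/

theorem spanning_adj {A : Finset (Sym2 V)} {a b : V} :
    (spanning A).Adj a b ↔ s(a, b) ∈ A ∧ a ≠ b := by
  simp [spanning]

theorem mem_edges {G : SimpleGraph V} {e : Sym2 V} : e ∈ edges G ↔ e ∈ G.edgeSet := by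
  simp [edges]

/-! ### Components of spanning subgraphs, and rank -/

/-- The partition of the vertex set into the components of `(V, A)`. -/
noncomputable def components (A : Finset (Sym2 V)) : Finpartition (univ : Finset V) :=
  Finpartition.ofSetoid (spanning A).reachableSetoid

theorem mem_part_components {A : Finset (Sym2 V)} {a b : V} :
    b ∈ (components A).part a ↔ (spanning A).Reachable a b :=
  Finpartition.mem_part_ofSetoid_iff_rel

theorem part_components_eq_iff {A : Finset (Sym2 V)} {a b : V} :
    (components A).part a = (components A).part b ↔ (spanning A).Reachable a b := by
  rw [← mem_part_components, Finpartition.mem_part_iff_part_eq_part _ (mem_univ _) (mem_univ _)]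
  exact eq_comm

theorem mem_parts_components {A : Finset (Sym2 V)} {B : Finset V} :
    B ∈ (components A).parts ↔ ∃ a, (components A).part a = B := by
  constructor
  · intro h
    obtain ⟨a, ha⟩ := (components A).nonempty_of_mem_parts h
    exact ⟨a, (components A).part_eq_of_mem h ha⟩
  · rintro ⟨a, rfl⟩
    exact (components A).part_mem.2 (mem_univ a)

theorem part_mem_components (A : Finset (Sym2 V)) (a : V) :
    (components A).part a ∈ (components A).parts :=
  (components A).part_mem.2 (mem_univ a)

theorem mem_part_self (A : Finset (Sym2 V)) (a : V) : a ∈ (components A).part a :=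
  mem_part_components.2 (SimpleGraph.Reachable.refl a)

theorem reachable_of_mem {A : Finset (Sym2 V)} {a b : V} (h : s(a, b) ∈ A) :
    (spanning A).Reachable a b := by
  by_cases hab : a = b
  · rw [hab]
  · exact (spanning_adj.2 ⟨h, hab⟩).reachable

/-- The components of `(V, A)` correspond to the parts of `components A`. -/
noncomputable def componentEquiv (A : Finset (Sym2 V)) :
    (spanning A).ConnectedComponent ≃ {B // B ∈ (components A).parts} :=
  Equiv.ofBijective
    (fun D => ⟨D.supp.toFinset, by
      induction D using SimpleGraph.ConnectedComponent.ind with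
      | _ v =>
        refine mem_parts_components.2 ⟨v, ?_⟩
        ext w
        simp [mem_part_components, SimpleGraph.reachable_comm]⟩)
    ⟨fun D D' h => by
      simpa using h, fun ⟨B, hB⟩ => by
      obtain ⟨v, rfl⟩ := mem_parts_components.1 hB
      refine ⟨(spanning A).connectedComponentMk v, Subtype.ext ?_⟩
      ext w
      simp [mem_part_components, SimpleGraph.reachable_comm]⟩

theorem componentEquiv_card (A : Finset (Sym2 V)) (D : (spanning A).ConnectedComponent) :
    (componentEquiv A D).1.card = Nat.card D.supp := by
  rw [Nat.card_coe_set_eq, Set.ncard_eq_toFinset_card']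
  rfl

theorem prod_connectedComponent {R : Type*} [CommMonoid R] (A : Finset (Sym2 V))
    [Fintype (spanning A).ConnectedComponent] (f : ℕ → R) :
    ∏ D : (spanning A).ConnectedComponent, f (Nat.card D.supp) =
      ∏ B ∈ (components A).parts, f B.card := by
  rw [← Finset.prod_coe_sort (components A).parts]
  exact Fintype.prod_equiv (componentEquiv A) _ (fun B => f B.1.card) fun D => by
    rw [componentEquiv_card]

theorem numComp_eq (A : Finset (Sym2 V)) : numComp A = (components A).parts.card := by
  rw [numComp, Nat.card_congr (componentEquiv A)]
  simp

theorem numComp_le (A : Finset (Sym2 V)) : numComp A ≤ Fintype.card V := by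
  rw [numComp_eq]
  exact (components A).card_parts_le_card

/-- Joining a representative of one component to representatives of the other k(A) - 1 makes the
graph connected, and a connected graph has at least |V| - 1 edges. -/
theorem card_le_card_add_numComp (A : Finset (Sym2 V)) :
    Fintype.card V ≤ A.card + numComp A := by
  rcases isEmpty_or_nonempty V with hV | ⟨⟨v⟩⟩
  · simp
  obtain ⟨rep, hmk⟩ : ∃ rep : (spanning A).ConnectedComponent → V,
      ∀ D, (spanning A).connectedComponentMk (rep D) = D := ⟨Quot.out, Quot.out_eq⟩
  set D₀ := (spanning A).connectedComponentMk v
  set A' : Finset (Sym2 V) := A ∪ (univ.erase D₀).image fun D => s(rep D₀, rep D)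
  have hle : spanning A ≤ spanning A' := fun a b h => by
    rw [spanning_adj] at h ⊢
    exact ⟨mem_union_left _ h.1, h.2⟩
  have hout : ∀ D : (spanning A).ConnectedComponent,
      (spanning A').Reachable (rep D₀) (rep D) := fun D => by
    by_cases hD : D = D₀
    · rw [hD]
    · exact reachable_of_mem (mem_union_right _ (mem_image.2 ⟨D, by simp [hD], rfl⟩))
  have hrep : ∀ w, (spanning A').Reachable (rep D₀) w := fun w => by
    refine (hout ((spanning A).connectedComponentMk w)).trans (SimpleGraph.Reachable.mono hle ?_)
    exact SimpleGraph.ConnectedComponent.exact (hmk _)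
  have hconn : (spanning A').Connected :=
    { preconnected := fun a b => (hrep a).symm.trans (hrep b)
      nonempty := ⟨v⟩ }
  have h1 := hconn.card_vert_le_card_edgeSet_add_one
  have h2 : Nat.card (spanning A').edgeSet ≤ A'.card := by
    rw [Nat.card_coe_set_eq, ← Set.ncard_coe_finset A']
    refine Set.ncard_le_ncard (fun e he => ?_) (Set.toFinite _)
    simp only [spanning, SimpleGraph.edgeSet_fromEdgeSet] at he
    exact he.1
  have h3 : A'.card ≤ A.card + ((univ : Finset (spanning A).ConnectedComponent).card - 1) := by
    refine (card_union_le _ _).trans (Nat.add_le_add_left (card_image_le.trans ?_) _)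
    rw [card_erase_of_mem (mem_univ _)]
  have h4 : 0 < (univ : Finset (spanning A).ConnectedComponent).card := card_pos.2 ⟨D₀, mem_univ _⟩
  have h5 : numComp A = (univ : Finset (spanning A).ConnectedComponent).card := by
    rw [numComp, Nat.card_eq_fintype_card, card_univ]
  rw [Nat.card_eq_fintype_card] at h1
  omega

/-- `|A| - r(A)` without nested truncated subtraction. -/
theorem card_sub_edgeRank_add (A : Finset (Sym2 V)) :
    A.card - edgeRank A + Fintype.card V = A.card + numComp A := by
  have h1 := numComp_le A
  have h2 := card_le_card_add_numComp A
  unfold edgeRank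
  omega

/-- This writes r(A) as a sum over components, so that a power y^r(A) can be distributed among them.
-/
theorem sum_card_sub_one (A : Finset (Sym2 V)) :
    ∑ B ∈ (components A).parts, (B.card - 1) + numComp A = Fintype.card V := by
  rw [numComp_eq, card_eq_sum_ones, ← sum_add_distrib, ← card_univ,
    ← (components A).sum_card_parts]
  refine sum_congr rfl fun B hB => ?_
  have := card_pos.2 ((components A).nonempty_of_mem_parts hB)
  omega

theorem aeval_UPoly {R : Type*} [CommRing R] [Algebra ℤ R] (a : UVar → R) (G : SimpleGraph V) :
    MvPolynomial.aeval a (UPoly G) = ∑ A ∈ (edges G).powerset,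
      a UVar.y ^ (A.card - edgeRank A) * ∏ B ∈ (components A).parts, a (UVar.x B.card) := by
  simp only [UPoly, map_sum, map_mul, map_pow, map_prod, MvPolynomial.aeval_X]
  refine sum_congr rfl fun A _ => ?_
  rw [prod_connectedComponent A fun i => a (UVar.x i)]

theorem UPoly_eq (G : SimpleGraph V) :
    UPoly G = ∑ A ∈ (edges G).powerset, MvPolynomial.X UVar.y ^ (A.card - edgeRank A) *
      ∏ B ∈ (components A).parts, MvPolynomial.X (UVar.x B.card) :=
  (MvPolynomial.aeval_X_left_apply _).symm.trans (aeval_UPoly MvPolynomial.X G)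

/-- The factors y^(|B|-1) multiply to y^r(A) and cancel the rank in the exponent. It serves the
substitution `collapse` and, with y = -1, both colouring invariants. -/
theorem aeval_UPoly_twist {R : Type*} [CommRing R] [Algebra ℤ R] (a : UVar → R) (c : ℕ → R)
    (h : ∀ i, 1 ≤ i → a (UVar.x i) = a UVar.y ^ (i - 1) * c i) (G : SimpleGraph V) :
    MvPolynomial.aeval a (UPoly G) = ∑ A ∈ (edges G).powerset,
      a UVar.y ^ A.card * ∏ B ∈ (components A).parts, c B.card := by
  rw [aeval_UPoly]
  refine sum_congr rfl fun A _ => ?_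
  rw [prod_congr rfl fun B hB => h B.card (card_pos.2 ((components A).nonempty_of_mem_parts hB)),
    prod_mul_distrib, prod_pow_eq_pow_sum, ← mul_assoc, ← pow_add]
  have h1 := card_sub_edgeRank_add A
  have h2 := sum_card_sub_one A
  congr 2
  omega

/-! ### Local functions and Kelly's lemma -/

/-- The permutation `e` restricts to an isomorphism from `G[S]` to `H[e(S)]`. -/
def InducedIso (G H : SimpleGraph V) (e : Equiv.Perm V) (S : Finset V) : Prop :=
  ∀ a ∈ S, ∀ b ∈ S, G.Adj a b ↔ H.Adj (e a) (e b)

/-- `F G S` depends only on the isomorphism type of `G[S]`. -/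
def IsLocal {R : Type*} (F : SimpleGraph V → Finset V → R) : Prop :=
  ∀ G H e S, InducedIso G H e S → F G S = F H (S.map e.toEmbedding)

theorem InducedIso.mono {G H : SimpleGraph V} {e : Equiv.Perm V} {S T : Finset V}
    (h : InducedIso G H e T) (hST : S ⊆ T) : InducedIso G H e S :=
  fun a ha b hb => h a (hST ha) b (hST hb)

/-- Letting the isomorphism fix v makes it a permutation of V, so all subgraphs can be handled as
subsets of one vertex set. -/
theorem IsReconstruction.exists_perm {G H : SimpleGraph V} (h : IsReconstruction G H) (v : V) :
    ∃ e : Equiv.Perm V, e v = v ∧ InducedIso G H e (univ.erase v) := by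
  obtain ⟨φ⟩ := h v
  have hφ : ∀ a (ha : a ≠ v), Equiv.Perm.ofSubtype (p := fun w => w ≠ v) φ.toEquiv a =
      (φ ⟨a, ha⟩ : V) := fun a ha => Equiv.Perm.ofSubtype_apply_of_mem (p := fun w => w ≠ v) _ ha
  refine ⟨Equiv.Perm.ofSubtype (p := fun w => w ≠ v) φ.toEquiv,
    Equiv.Perm.ofSubtype_apply_of_not_mem _ (by simp), fun a ha b hb => ?_⟩
  rw [hφ a (ne_of_mem_erase ha), hφ b (ne_of_mem_erase hb)]
  exact (φ.map_adj_iff (v := ⟨a, ne_of_mem_erase ha⟩) (w := ⟨b, ne_of_mem_erase hb⟩)).symm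

theorem sum_powerset_map {α R : Type*} [AddCommMonoid R] (e : Equiv.Perm α) (S : Finset α)
    (f : Finset α → R) :
    ∑ T ∈ (S.map e.toEmbedding).powerset, f T = ∑ T ∈ S.powerset, f (T.map e.toEmbedding) := by
  refine (sum_bij' (fun T _ => T.map e.toEmbedding) (fun T _ => T.map e.symm.toEmbedding)
    ?_ ?_ ?_ ?_ ?_).symm
  · intro T hT
    simpa using hT
  · intro T hT
    have := map_subset_map (f := e.symm.toEmbedding).2 (mem_powerset.1 hT)
    simpa [map_map] using this
  · intro T _
    simp [map_map]
  · intro T _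
    simp [map_map]
  · intro T _
    rfl

variable {R : Type*} [CommRing R]

theorem IsLocal.sum_powerset {F : SimpleGraph V → Finset V → R} (hF : IsLocal F) (i : ℕ) :
    IsLocal fun G S => ∑ T ∈ S.powerset with T.card = i, F G T := by
  intro G H e S h
  simp only [sum_filter]
  rw [sum_powerset_map]
  refine sum_congr rfl fun T hT => ?_
  rw [card_map, hF G H e T (h.mono (mem_powerset.1 hT))]

theorem IsLocal.mul {F F' : SimpleGraph V → Finset V → R} (hF : IsLocal F) (hF' : IsLocal F') :
    IsLocal fun G S => F G S * F' G S := fun G H e S h => by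
  simp only [hF G H e S h, hF' G H e S h]

theorem IsLocal.card_mul {F : SimpleGraph V → Finset V → R} (hF : IsLocal F) (c : ℕ → R) :
    IsLocal fun G S => c S.card * F G S := fun G H e S h => by
  simp only [hF G H e S h, card_map]

/-- Kelly's lemma: sums of local functions over the proper subsets of the vertex set are
reconstructible. -/
theorem IsReconstruction.sum_proper [NoZeroDivisors R] [CharZero R] {G H : SimpleGraph V}
    (h : IsReconstruction G H) {F : SimpleGraph V → Finset V → R} (hF : IsLocal F) :
    ∑ S ∈ univ.erase univ, F G S = ∑ S ∈ univ.erase univ, F H S := by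
  -- A set of size i < |V| is missed by |V| - i vertices, so it is counted |V| - i times over the
  -- vertex-deleted subgraphs. This weight raises every multiplicity to |V|! without division in R.
  set c : ℕ → R := fun i => (((Fintype.card V).factorial / (Fintype.card V - i) : ℕ) : R)
  have key : ∀ K : SimpleGraph V, ((Fintype.card V).factorial : R) * ∑ S ∈ univ.erase univ, F K S =
      ∑ v, ∑ S ∈ (univ.erase v).powerset, c S.card * F K S := fun K => by
    have h1 : ∀ v : V, ∑ S ∈ (univ.erase v).powerset, c S.card * F K S =
        ∑ S, if v ∉ S then c S.card * F K S else 0 := fun v => by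
      rw [← sum_filter]
      refine sum_congr ?_ fun _ _ => rfl
      ext S
      simp [subset_erase]
    simp only [h1]
    rw [sum_comm, mul_sum, ← add_sum_erase univ _ (mem_univ univ)]
    simp only [mem_univ, not_true_eq_false, if_false, sum_const_zero, zero_add]
    refine sum_congr rfl fun S hS => ?_
    have hlt : S.card < Fintype.card V := by
      rw [← card_univ]
      exact card_lt_card (ssubset_univ_iff.2 (ne_of_mem_erase hS))
    rw [← sum_filter, sum_const, nsmul_eq_mul, ← mul_assoc, ← Nat.cast_mul]
    have h2 : (univ.filter fun v => v ∉ S).card = Fintype.card V - S.card := by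
      rw [← card_compl]
      congr 1
      ext v
      simp
    rw [h2, Nat.mul_div_cancel' (Nat.dvd_factorial (by omega) (Nat.sub_le _ _))]
  refine mul_left_cancel₀ (Nat.cast_ne_zero.2 (Nat.factorial_ne_zero (Fintype.card V))) ?_
  rw [key, key]
  refine sum_congr rfl fun v _ => ?_
  obtain ⟨e, hev, he⟩ := h.exists_perm v
  have hmap : (univ.erase v).map e.toEmbedding = univ.erase v := by
    rw [map_erase]
    simp [hev]
  conv_rhs => rw [← hmap, sum_powerset_map]
  refine sum_congr rfl fun S hS => ?_
  rw [card_map, hF G H e S (he.mono (mem_powerset.1 hS))]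

/-! ### Kocay's lemma for complementary pairs -/

theorem sum_neg_one_pow_card_compl (S : Finset V) :
    ∑ X, (if S ⊆ X then (-1 : R) ^ Xᶜ.card else 0) = if S = univ then 1 else 0 := by
  have h1 : ∑ X, (if S ⊆ X then (-1 : R) ^ Xᶜ.card else 0) =
      ∑ Y ∈ Sᶜ.powerset, (-1 : R) ^ Y.card := by
    rw [← sum_filter]
    refine sum_bij' (fun X _ => Xᶜ) (fun X _ => Xᶜ) ?_ ?_ ?_ ?_ ?_ <;> simp
    intro Y hY
    exact subset_compl_comm.1 hY
  have h2 := congrArg (Int.cast : ℤ → R) (sum_powerset_neg_one_pow_card (x := Sᶜ))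
  push_cast at h2
  rw [h1, h2]
  simp

/-- The alternating sum over X ⊇ S ∪ T keeps the pairs with S ∪ T = V; since |S| + |T| = |V|, these
are exactly the complementary ones. -/
theorem sum_compl_eq_inclusion_exclusion (a b : Finset V → R) (i : ℕ) :
    ∑ S with S.card = i, a S * b Sᶜ =
      ∑ X : Finset V, (-1) ^ Xᶜ.card * ((∑ S ∈ X.powerset with S.card = i, a S) *
        ∑ T ∈ X.powerset with T.card = Fintype.card V - i, b T) := by
  have h1 : ∀ X : Finset V, (-1) ^ Xᶜ.card * ((∑ S ∈ X.powerset with S.card = i, a S) *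
        ∑ T ∈ X.powerset with T.card = Fintype.card V - i, b T) =
      ∑ S with S.card = i, ∑ T with T.card = Fintype.card V - i,
        a S * b T * if S ∪ T ⊆ X then (-1 : R) ^ Xᶜ.card else 0 := fun X => by
    have h2 : ∀ j, ∀ f : Finset V → R, ∑ S ∈ X.powerset with S.card = j, f S =
        ∑ S with S.card = j, if S ⊆ X then f S else 0 := fun j f => by
      rw [← sum_filter]
      refine sum_congr ?_ fun _ _ => rfl
      ext S
      simp [and_comm]
    rw [h2, h2, sum_mul_sum, mul_sum]
    refine sum_congr rfl fun S _ => ?_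
    rw [mul_sum]
    refine sum_congr rfl fun T _ => ?_
    by_cases hS : S ⊆ X <;> by_cases hT : T ⊆ X <;> simp [union_subset_iff, hS, hT]
    ring
  simp only [h1]
  rw [sum_comm]
  refine sum_congr rfl fun S hS => ?_
  rw [sum_comm]
  simp only [← mul_sum, sum_neg_one_pow_card_compl]
  rw [sum_eq_single Sᶜ]
  · simp
  · intro T hT hne
    have hS' := (mem_filter.1 hS).2
    have hT' := (mem_filter.1 hT).2
    rw [if_neg, mul_zero]
    intro hu
    refine hne (eq_of_subset_of_card_le (fun x hx => ?_) ?_).symm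
    · have := mem_univ x
      rw [← hu, mem_union] at this
      exact this.resolve_left (mem_compl.1 hx)
    · rw [card_compl, hS', hT']
  · intro hn
    exfalso
    refine hn (mem_filter.2 ⟨mem_univ _, ?_⟩)
    rw [card_compl, (mem_filter.1 hS).2]

/-- Kocay's lemma for pairs of complementary vertex sets. -/
theorem IsReconstruction.sum_compl [NoZeroDivisors R] [CharZero R] {G H : SimpleGraph V}
    (h : IsReconstruction G H) {a b : SimpleGraph V → Finset V → R} (ha : IsLocal a)
    (hb : IsLocal b) {i : ℕ} (hi : 0 < i) (hi' : i < Fintype.card V) :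
    ∑ S with S.card = i, a G S * b G Sᶜ = ∑ S with S.card = i, a H S * b H Sᶜ := by
  -- For the term X = V: both sizes, i and |V| - i, are less than |V|, so each factor is a Kelly
  -- sum.
  have huniv : ∀ {f : SimpleGraph V → Finset V → R}, IsLocal f → ∀ j < Fintype.card V,
      ∑ S ∈ univ.powerset with S.card = j, f G S = ∑ S ∈ univ.powerset with S.card = j, f H S := by
    intro f hf j hj
    have h1 := h.sum_proper (hf.card_mul fun k => if k = j then 1 else 0)
    have h2 : ∀ K, ∑ S ∈ univ.powerset with S.card = j, f K S =
        ∑ S ∈ univ.erase univ, (if S.card = j then 1 else 0) * f K S := fun K => by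
      rw [sum_erase _ (by simp [card_univ, hj.ne']), powerset_univ, sum_filter]
      exact sum_congr rfl fun S _ => by split_ifs <;> simp
    rw [h2, h2, h1]
  rw [sum_compl_eq_inclusion_exclusion, sum_compl_eq_inclusion_exclusion,
    ← add_sum_erase univ _ (mem_univ univ), ← add_sum_erase univ _ (mem_univ univ),
    huniv ha i hi', huniv hb _ (by omega)]
  congr 1
  -- For the terms X ≠ V: the signed product of the two inner sums is itself a local function of X.
  have h3 := h.sum_proper
    (((ha.sum_powerset i).mul (hb.sum_powerset (Fintype.card V - i))).card_mul
      fun k => (-1) ^ (Fintype.card V - k))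
  simpa only [card_compl] using h3

/-! ### Edge sets split by a vertex set and its complement -/

/-- No edge crosses between S and its complement, so a walk starting in S stays there and uses only
A₁. -/
theorem reachable_union_iff {A₁ A₂ : Finset (Sym2 V)} {S : Finset V} (h₁ : A₁ ⊆ S.sym2)
    (h₂ : A₂ ⊆ Sᶜ.sym2) {a b : V} (ha : a ∈ S) :
    (spanning (A₁ ∪ A₂)).Reachable a b ↔ (spanning A₁).Reachable a b := by
  constructor
  · intro h
    rw [SimpleGraph.reachable_iff_reflTransGen] at h
    suffices b ∈ S ∧ (spanning A₁).Reachable a b from this.2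
    induction h with
    | refl => exact ⟨ha, SimpleGraph.Reachable.refl a⟩
    | tail _ hbc ih =>
      have hbc' := (spanning_adj.1 hbc).1
      rcases mem_union.1 hbc' with h | h
      · exact ⟨(mk_mem_sym2_iff.1 (h₁ h)).2, ih.2.trans (reachable_of_mem h)⟩
      · exact absurd ih.1 (mem_compl.1 (mk_mem_sym2_iff.1 (h₂ h)).1)
  · exact SimpleGraph.Reachable.mono fun a b h => by
      rw [spanning_adj] at h ⊢
      exact ⟨mem_union_left _ h.1, h.2⟩

theorem part_components_union {A₁ A₂ : Finset (Sym2 V)} {S : Finset V} (h₁ : A₁ ⊆ S.sym2)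
    (h₂ : A₂ ⊆ Sᶜ.sym2) {a : V} (ha : a ∈ S) :
    (components (A₁ ∪ A₂)).part a = (components A₁).part a := by
  ext b
  rw [mem_part_components, mem_part_components, reachable_union_iff h₁ h₂ ha]

theorem part_components_empty (a : V) : (components (∅ : Finset (Sym2 V))).part a = {a} := by
  ext b
  rw [mem_part_components, mem_singleton, SimpleGraph.reachable_iff_reflTransGen]
  constructor
  · intro h
    induction h with
    | refl => rfl
    | tail _ hbc _ => exact absurd (spanning_adj.1 hbc).1 (notMem_empty _)
  · rintro rfl
    exact Relation.ReflTransGen.refl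

theorem part_components_subset {A : Finset (Sym2 V)} {S : Finset V} (h : A ⊆ S.sym2) {a : V}
    (ha : a ∈ S) : (components A).part a ⊆ S := by
  intro b hb
  by_contra hbS
  have h1 := part_components_union (S := Sᶜ) (A₁ := ∅) (A₂ := A) (by simp) (by simpa using h)
    (mem_compl.2 hbS)
  rw [empty_union, part_components_empty] at h1
  have h2 := part_components_eq_iff.2 (mem_part_components.1 hb)
  rw [h1] at h2
  have h3 := mem_part_self A a
  rw [h2, mem_singleton] at h3
  exact hbS (h3 ▸ ha)

/-- Both edge sets live on all of V, so each sees the opposite side as singletons; the images keep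
only the components on the relevant side. -/
theorem prod_components_union {R : Type*} [CommMonoid R] {A₁ A₂ : Finset (Sym2 V)} {S : Finset V}
    (h₁ : A₁ ⊆ S.sym2) (h₂ : A₂ ⊆ Sᶜ.sym2) (f : Finset V → R) :
    ∏ B ∈ (components (A₁ ∪ A₂)).parts, f B =
      (∏ B ∈ S.image (components A₁).part, f B) * ∏ B ∈ Sᶜ.image (components A₂).part, f B := by
  rw [← prod_union]
  · refine prod_congr ?_ fun _ _ => rfl
    have e₁ : ∀ a ∈ S, (components (A₁ ∪ A₂)).part a = (components A₁).part a :=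
      fun a ha => part_components_union h₁ h₂ ha
    have e₂ : ∀ a ∈ Sᶜ, (components (A₁ ∪ A₂)).part a = (components A₂).part a := fun a ha => by
      rw [union_comm]
      exact part_components_union h₂ (by rwa [compl_compl]) ha
    ext B
    rw [mem_parts_components, ← image_congr (fun a ha => e₁ a ha),
      ← image_congr (fun a ha => e₂ a ha), ← image_union, union_compl]
    simp
  · rw [disjoint_left]
    intro B hB₁ hB₂
    obtain ⟨a, ha, rfl⟩ := mem_image.1 hB₁
    obtain ⟨b, hb, hab⟩ := mem_image.1 hB₂
    have h3 := part_components_subset h₂ hb (hab ▸ mem_part_self A₁ a)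
    exact mem_compl.1 h3 ha

theorem prod_components_of_subset {R : Type*} [CommMonoid R] {A : Finset (Sym2 V)} {S : Finset V}
    (h : A ⊆ S.sym2) (f : ℕ → R) :
    ∏ B ∈ (components A).parts, f B.card =
      (∏ B ∈ S.image (components A).part, f B.card) * f 1 ^ Sᶜ.card := by
  have h1 := prod_components_union h (empty_subset Sᶜ.sym2) fun B => f B.card
  rw [union_empty] at h1
  rw [h1]
  congr 1
  rw [prod_image]
  · simp [part_components_empty]
  · intro a _ b _ hab
    simpa [part_components_empty] using hab

/-! ### Weights of edge sets, and the decomposition of `U` at a component -/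

/-- The weight of `A` in `y ^ |V| * U`. -/
noncomputable def edgeWeight (A : Finset (Sym2 V)) : MvPolynomial UVar ℤ :=
  MvPolynomial.X UVar.y ^ A.card *
    ∏ B ∈ (components A).parts, (MvPolynomial.X UVar.y * MvPolynomial.X (UVar.x B.card))

theorem edgeWeight_eq (A : Finset (Sym2 V)) :
    edgeWeight A = MvPolynomial.X UVar.y ^ Fintype.card V *
      (MvPolynomial.X UVar.y ^ (A.card - edgeRank A) *
        ∏ B ∈ (components A).parts, MvPolynomial.X (UVar.x B.card)) := by
  rw [edgeWeight, prod_mul_distrib, prod_const, ← mul_assoc, ← mul_assoc, ← pow_add, ← pow_add,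
    ← numComp_eq, ← card_sub_edgeRank_add, add_comm]

/-- The surplus singletons number |Sᶜ| for A₁ and |S| for A₂, together |V|, and each contributes y
x₁. -/
theorem edgeWeight_mul {A₁ A₂ : Finset (Sym2 V)} {S : Finset V}
    (h₁ : A₁ ⊆ S.sym2) (h₂ : A₂ ⊆ Sᶜ.sym2) :
    edgeWeight A₁ * edgeWeight A₂ = edgeWeight (A₁ ∪ A₂) *
      (MvPolynomial.X UVar.y * MvPolynomial.X (UVar.x 1)) ^ Fintype.card V := by
  have hdisj : Disjoint A₁ A₂ := by
    rw [disjoint_left]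
    intro e he₁ he₂
    induction e using Sym2.ind with
    | _ a b => exact mem_compl.1 (mk_mem_sym2_iff.1 (h₂ he₂)).1 (mk_mem_sym2_iff.1 (h₁ he₁)).1
  have hc : Sᶜ.card + Sᶜᶜ.card = Fintype.card V := by
    rw [compl_compl, card_compl, Nat.sub_add_cancel (card_le_univ S)]
  unfold edgeWeight
  rw [prod_components_union h₁ h₂, card_union_of_disjoint hdisj, ← hc, pow_add, pow_add,
    prod_components_of_subset h₁ fun i => MvPolynomial.X UVar.y * MvPolynomial.X (UVar.x i),
    prod_components_of_subset h₂ fun i => MvPolynomial.X UVar.y * MvPolynomial.X (UVar.x i)]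
  ring

/-- The permutation of the unordered pairs induced by a permutation of the vertices. -/
def permSym2 (e : Equiv.Perm V) : Equiv.Perm (Sym2 V) where
  toFun := Sym2.map e
  invFun := Sym2.map e.symm
  left_inv z := by simp [Sym2.map_map]
  right_inv z := by simp [Sym2.map_map]

theorem permSym2_mk (e : Equiv.Perm V) (a b : V) : permSym2 e s(a, b) = s(e a, e b) := rfl

theorem reachable_map_iff (e : Equiv.Perm V) (A : Finset (Sym2 V)) {a b : V} :
    (spanning (A.map (permSym2 e).toEmbedding)).Reachable (e a) (e b) ↔
      (spanning A).Reachable a b := by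
  let φ : spanning A ≃g spanning (A.map (permSym2 e).toEmbedding) :=
    { toEquiv := e
      map_rel_iff' := fun {a b} => by
        rw [spanning_adj, spanning_adj, ← permSym2_mk, ← Equiv.coe_toEmbedding, mem_map']
        simp }
  exact φ.reachable_iff

theorem part_components_map (e : Equiv.Perm V) (A : Finset (Sym2 V)) (a : V) :
    (components (A.map (permSym2 e).toEmbedding)).part (e a) =
      ((components A).part a).map e.toEmbedding := by
  ext b
  obtain ⟨b, rfl⟩ := e.surjective b
  rw [mem_part_components, reachable_map_iff, ← mem_part_components, ← Equiv.coe_toEmbedding,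
    mem_map']

theorem parts_components_map (e : Equiv.Perm V) (A : Finset (Sym2 V)) :
    (components (A.map (permSym2 e).toEmbedding)).parts =
      (components A).parts.map (mapEmbedding e.toEmbedding).toEmbedding := by
  ext B
  simp only [mem_parts_components, mem_map]
  constructor
  · rintro ⟨a, rfl⟩
    obtain ⟨a, rfl⟩ := e.surjective a
    exact ⟨_, ⟨a, rfl⟩, (part_components_map e A a).symm⟩
  · rintro ⟨_, ⟨a, rfl⟩, rfl⟩
    exact ⟨e a, part_components_map e A a⟩

theorem edgeWeight_map (e : Equiv.Perm V) (A : Finset (Sym2 V)) :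
    edgeWeight (A.map (permSym2 e).toEmbedding) = edgeWeight A := by
  simp [edgeWeight, parts_components_map]

/-- Sums over the edge sets of induced subgraphs are local. -/
theorem isLocal_sum {R : Type*} [CommRing R] (Φ : Finset V → Finset (Sym2 V) → R)
    (hΦ : ∀ e S A, Φ (S.map e.toEmbedding) (A.map (permSym2 e).toEmbedding) = Φ S A) :
    IsLocal fun G S => ∑ A ∈ (edges G ∩ S.sym2).powerset, Φ S A := by
  intro G H e S h
  have h1 : edges H ∩ (S.map e.toEmbedding).sym2 =
      (edges G ∩ S.sym2).map (permSym2 e).toEmbedding := by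
    ext z
    obtain ⟨z, rfl⟩ := (permSym2 e).surjective z
    rw [← Equiv.coe_toEmbedding, mem_map']
    induction z using Sym2.ind with
    | _ a b =>
      simp only [Equiv.coe_toEmbedding, permSym2_mk, mem_inter, mem_edges, mk_mem_sym2_iff,
        SimpleGraph.mem_edgeSet]
      rw [← Equiv.coe_toEmbedding, mem_map', mem_map']
      exact and_congr_left fun hab => (h a hab.1 b hab.2).symm
  simp only [h1, sum_powerset_map, hΦ]

/-- The `U`-polynomial of `G[S]`, up to powers of `y` and `x₁`. -/
noncomputable def totalWeight (G : SimpleGraph V) (S : Finset V) : MvPolynomial UVar ℤ :=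
  ∑ A ∈ (edges G ∩ S.sym2).powerset, edgeWeight A

/-- The contribution to `totalWeight G S` of the edge sets that connect `S`. -/
noncomputable def connectedWeight (G : SimpleGraph V) (S : Finset V) : MvPolynomial UVar ℤ :=
  ∑ A ∈ (edges G ∩ S.sym2).powerset, if S ∈ (components A).parts then edgeWeight A else 0

theorem isLocal_totalWeight : IsLocal (totalWeight (V := V)) :=
  isLocal_sum (fun _ A => edgeWeight A) fun e _ A => edgeWeight_map e A

theorem isLocal_connectedWeight : IsLocal (connectedWeight (V := V)) :=
  isLocal_sum (fun S A => if S ∈ (components A).parts then edgeWeight A else 0) fun e S A => by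
    rw [edgeWeight_map, parts_components_map]
    congr 1
    exact propext (mem_map' (mapEmbedding e.toEmbedding).toEmbedding (a := S))

theorem inter_sym2_union {A : Finset (Sym2 V)} {S : Finset V} (h : S ∈ (components A).parts) :
    (A ∩ S.sym2) ∪ (A ∩ Sᶜ.sym2) = A := by
  refine Subset.antisymm (union_subset inter_subset_left inter_subset_left) fun z hz => ?_
  obtain ⟨v, rfl⟩ := mem_parts_components.1 h
  induction z using Sym2.ind with
  | _ a b =>
    have hab := reachable_of_mem hz
    simp only [mem_union, mem_inter, mk_mem_sym2_iff, mem_compl, mem_part_components]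
    by_cases ha : (spanning A).Reachable v a
    · exact Or.inl ⟨hz, ha, ha.trans hab⟩
    · exact Or.inr ⟨hz, ha, fun hb => ha (hb.trans hab.symm)⟩

theorem union_inter_sym2 {A₁ A₂ : Finset (Sym2 V)} {S : Finset V} (h₁ : A₁ ⊆ S.sym2)
    (h₂ : A₂ ⊆ Sᶜ.sym2) : (A₁ ∪ A₂) ∩ S.sym2 = A₁ := by
  ext z
  rw [mem_inter, mem_union]
  refine ⟨fun ⟨h, hz⟩ => h.resolve_right fun h' => ?_, fun h => ⟨Or.inl h, h₁ h⟩⟩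
  induction z using Sym2.ind with
  | _ a b => exact mem_compl.1 (mk_mem_sym2_iff.1 (h₂ h')).1 (mk_mem_sym2_iff.1 hz).1

theorem mem_parts_components_union {A₁ A₂ : Finset (Sym2 V)} {S : Finset V} (h₁ : A₁ ⊆ S.sym2)
    (h₂ : A₂ ⊆ Sᶜ.sym2) (hS : S.Nonempty) :
    S ∈ (components (A₁ ∪ A₂)).parts ↔ S ∈ (components A₁).parts := by
  obtain ⟨a, ha⟩ := hS
  have key : ∀ A, S ∈ (components A).parts ↔ (components A).part a = S := fun A =>
    ⟨fun h => (components A).part_eq_of_mem h ha, fun h => mem_parts_components.2 ⟨a, h⟩⟩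
  rw [key, key, part_components_union h₁ h₂ ha]

/-- An edge set having S as a component is an edge set connecting S together with an arbitrary one
on the complement. -/
theorem connectedWeight_mul_totalWeight (G : SimpleGraph V) {S : Finset V} (hS : S.Nonempty) :
    connectedWeight G S * totalWeight G Sᶜ =
      (∑ A ∈ (edges G).powerset, if S ∈ (components A).parts then edgeWeight A else 0) *
        (MvPolynomial.X UVar.y * MvPolynomial.X (UVar.x 1)) ^ Fintype.card V := by
  rw [connectedWeight, totalWeight, ← sum_filter, ← sum_filter, sum_mul_sum, ← sum_product', sum_mul]
  refine sum_bij' (fun p _ => p.1 ∪ p.2) (fun A _ => (A ∩ S.sym2, A ∩ Sᶜ.sym2)) ?_ ?_ ?_ ?_ ?_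
  · rintro ⟨A₁, A₂⟩ h
    simp only [mem_product, mem_filter, mem_powerset, subset_inter_iff] at h ⊢
    exact ⟨union_subset h.1.1.1 h.2.1, (mem_parts_components_union h.1.1.2 h.2.2 hS).2 h.1.2⟩
  · intro A h
    simp only [mem_product, mem_filter, mem_powerset] at h ⊢
    refine ⟨⟨inter_subset_inter_right h.1, ?_⟩, inter_subset_inter_right h.1⟩
    rw [← mem_parts_components_union inter_subset_right inter_subset_right hS,
      inter_sym2_union h.2]
    exact h.2
  · rintro ⟨A₁, A₂⟩ h
    simp only [mem_product, mem_filter, mem_powerset, subset_inter_iff] at h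
    refine Prod.ext (union_inter_sym2 h.1.1.2 h.2.2) ?_
    dsimp only
    rw [union_comm]
    exact union_inter_sym2 h.2.2 (by simpa using h.1.1.2)
  · intro A h
    exact inter_sym2_union (mem_filter.1 h).2
  · rintro ⟨A₁, A₂⟩ h
    simp only [mem_product, mem_filter, mem_powerset, subset_inter_iff] at h
    exact edgeWeight_mul h.1.1.2 h.2.2

/-- Double counting: each A is counted once per component S with weight |S|, hence |V| times in all.
-/
theorem sum_card_mul_connectedWeight (G : SimpleGraph V) :
    ∑ S : Finset V, (S.card : MvPolynomial UVar ℤ) * connectedWeight G S * totalWeight G Sᶜ =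
      (Fintype.card V : MvPolynomial UVar ℤ) * (∑ A ∈ (edges G).powerset, edgeWeight A) *
        (MvPolynomial.X UVar.y * MvPolynomial.X (UVar.x 1)) ^ Fintype.card V := by
  have h1 : ∀ S : Finset V,
      (S.card : MvPolynomial UVar ℤ) * connectedWeight G S * totalWeight G Sᶜ =
      (∑ A ∈ (edges G).powerset, if S ∈ (components A).parts then
        (S.card : MvPolynomial UVar ℤ) * edgeWeight A else 0) *
        (MvPolynomial.X UVar.y * MvPolynomial.X (UVar.x 1)) ^ Fintype.card V := fun S => by
    rcases S.eq_empty_or_nonempty with rfl | hS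
    · simp
    · rw [mul_assoc, connectedWeight_mul_totalWeight G hS, ← mul_assoc, mul_sum]
      simp only [mul_ite, mul_zero]
  simp only [h1]
  rw [← sum_mul, sum_comm, mul_sum]
  congr 1
  refine sum_congr rfl fun A _ => ?_
  rw [← sum_filter, ← sum_mul, ← Nat.cast_sum, filter_mem_eq_inter, univ_inter,
    (components A).sum_card_parts, card_univ]

/-! ### Reconstruction of the number of edges and of `U` -/

theorem card_edges_eq (G : SimpleGraph V) :
    ((edges G).card : ℤ) = ∑ S : Finset V, if S.card = 2 then ((edges G ∩ S.sym2).card : ℤ) else 0 := by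
  have h1 : ∀ S : Finset V, (if S.card = 2 then ((edges G ∩ S.sym2).card : ℤ) else 0) =
      ∑ z ∈ edges G, if S.card = 2 ∧ z ∈ S.sym2 then 1 else 0 := fun S => by
    split_ifs with h <;> simp [h, ← filter_mem_eq_inter]
  simp only [h1]
  rw [sum_comm, card_eq_sum_ones, Nat.cast_sum]
  refine sum_congr rfl fun z hz => ?_
  rw [mem_edges] at hz
  induction z using Sym2.ind with
  | _ a b =>
    have hab : a ≠ b := (SimpleGraph.mem_edgeSet G |>.1 hz).ne
    rw [sum_eq_single {a, b}]
    · simp [card_pair hab]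
    · intro S _ hS
      rw [if_neg]
      rintro ⟨hc, hm⟩
      rw [mk_mem_sym2_iff] at hm
      refine hS (eq_of_subset_of_card_le ?_ ?_).symm
      · simp [insert_subset_iff, hm.1, hm.2]
      · rw [card_pair hab, hc]
    · simp

/-- With at least three vertices, the pairs spanned by edges are proper subsets of V. Counting
one-element edge subsets puts the edge count in the form of `isLocal_sum`. -/
theorem IsReconstruction.card_edges {G H : SimpleGraph V} (hV : 3 ≤ Fintype.card V)
    (h : IsReconstruction G H) : (edges G).card = (edges H).card := by
  have hloc : IsLocal fun (G : SimpleGraph V) S =>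
      (if S.card = 2 then 1 else 0) * ∑ A ∈ (edges G ∩ S.sym2).powerset,
        if A.card = 1 then (1 : ℤ) else 0 :=
    IsLocal.card_mul (isLocal_sum (fun _ A => if A.card = 1 then 1 else 0) (by simp))
      fun i => if i = 2 then 1 else 0
  have h1 := h.sum_proper hloc
  have h2 : ∀ K : SimpleGraph V, ((edges K).card : ℤ) = ∑ S ∈ univ.erase univ,
      (if S.card = 2 then 1 else 0) * ∑ A ∈ (edges K ∩ S.sym2).powerset,
        if A.card = 1 then (1 : ℤ) else 0 := fun K => by
    rw [card_edges_eq, sum_erase _ (by rw [card_univ, if_neg (by omega), zero_mul])]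
    refine sum_congr rfl fun S _ => ?_
    rw [← sum_filter, ← powersetCard_eq_filter]
    simp
  rw [← h2, ← h2] at h1
  exact_mod_cast h1

/-- The term S = V is isolated, and S = ∅ drops out because of the factor |S|; what remains is
within reach of Kocay's lemma. -/
theorem card_mul_sum_edgeWeight (G : SimpleGraph V) [Nonempty V] :
    (Fintype.card V : MvPolynomial UVar ℤ) * (∑ A ∈ (edges G).powerset, edgeWeight A) *
        (MvPolynomial.X UVar.y * MvPolynomial.X (UVar.x 1)) ^ Fintype.card V =
      (Fintype.card V : MvPolynomial UVar ℤ) * connectedWeight G univ *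
        (MvPolynomial.X UVar.y * MvPolynomial.X (UVar.x 1)) ^ Fintype.card V +
      ∑ i ∈ Ioo 0 (Fintype.card V), ∑ S : Finset V with S.card = i,
        (S.card : MvPolynomial UVar ℤ) * connectedWeight G S * totalWeight G Sᶜ := by
  rw [← sum_card_mul_connectedWeight, ← add_sum_erase univ _ (mem_univ univ)]
  congr 1
  · rw [mul_assoc, connectedWeight_mul_totalWeight G univ_nonempty, ← mul_assoc, connectedWeight,
      sym2_univ, inter_univ, card_univ]
  · rw [← add_sum_erase (univ.erase univ) _
      (mem_erase.2 ⟨univ_nonempty.ne_empty.symm, mem_univ ∅⟩), card_empty]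
    simp only [Nat.cast_zero, zero_mul, zero_add]
    symm
    rw [sum_fiberwise_eq_sum_filter]
    refine sum_congr ?_ fun _ _ => rfl
    ext S
    simp only [mem_filter, mem_univ, true_and, mem_Ioo, mem_erase, and_true, card_pos,
      nonempty_iff_ne_empty]
    refine and_congr_right fun _ => ?_
    rw [lt_iff_le_and_ne, and_iff_right (card_le_univ S), Ne, card_eq_iff_eq_univ]

theorem IsReconstruction.sum_edgeWeight_sub {G H : SimpleGraph V} [Nonempty V]
    (h : IsReconstruction G H) :
    ∑ A ∈ (edges G).powerset, edgeWeight A - ∑ A ∈ (edges H).powerset, edgeWeight A =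
      connectedWeight G univ - connectedWeight H univ := by
  have hG := card_mul_sum_edgeWeight G
  have hH := card_mul_sum_edgeWeight H
  have hmid : ∑ i ∈ Ioo 0 (Fintype.card V), ∑ S : Finset V with S.card = i,
        (S.card : MvPolynomial UVar ℤ) * connectedWeight G S * totalWeight G Sᶜ =
      ∑ i ∈ Ioo 0 (Fintype.card V), ∑ S : Finset V with S.card = i,
        (S.card : MvPolynomial UVar ℤ) * connectedWeight H S * totalWeight H Sᶜ :=
    sum_congr rfl fun i hi => h.sum_compl (isLocal_connectedWeight.card_mul fun i => i)
      isLocal_totalWeight (mem_Ioo.1 hi).1 (mem_Ioo.1 hi).2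
  rw [hmid] at hG
  have h0 : (Fintype.card V : MvPolynomial UVar ℤ) *
      (MvPolynomial.X UVar.y * MvPolynomial.X (UVar.x 1)) ^ Fintype.card V ≠ 0 :=
    mul_ne_zero (Nat.cast_ne_zero.2 Fintype.card_ne_zero)
      (pow_ne_zero _ (mul_ne_zero (MvPolynomial.X_ne_zero _) (MvPolynomial.X_ne_zero _)))
  refine mul_left_cancel₀ h0 ?_
  linear_combination hG - hH

/-- The generating function of the edge sets that connect all vertices. -/
noncomputable def connectedSum (G : SimpleGraph V) : MvPolynomial UVar ℤ :=
  ∑ A ∈ (edges G).powerset with univ ∈ (components A).parts, MvPolynomial.X UVar.y ^ A.card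

theorem connectedWeight_univ (G : SimpleGraph V) :
    connectedWeight G univ = MvPolynomial.X UVar.y * MvPolynomial.X (UVar.x (Fintype.card V)) *
      connectedSum G := by
  rw [connectedWeight, sym2_univ, inter_univ, ← sum_filter, connectedSum, mul_sum]
  refine sum_congr rfl fun A hA => ?_
  have hparts : (components A).parts = {univ} := by
    have huniv := (mem_filter.1 hA).2
    refine eq_singleton_iff_unique_mem.2 ⟨huniv, fun B hB => ?_⟩
    obtain ⟨b, hb⟩ := (components A).nonempty_of_mem_parts hB
    rw [← (components A).part_eq_of_mem hB hb, (components A).part_eq_of_mem huniv (mem_univ b)]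
  rw [edgeWeight, hparts, prod_singleton, card_univ]
  ring

/-- The substitution `x_i = y ^ (i - 1)`, which turns `U` into `(1 + y) ^ |E|`. -/
noncomputable def collapse : MvPolynomial UVar ℤ →ₐ[ℤ] MvPolynomial UVar ℤ :=
  MvPolynomial.aeval fun
    | UVar.x i => MvPolynomial.X UVar.y ^ (i - 1)
    | UVar.y => MvPolynomial.X UVar.y

theorem collapse_X_y : collapse (MvPolynomial.X UVar.y) = MvPolynomial.X UVar.y := by
  simp [collapse]

theorem collapse_X_x (i : ℕ) :
    collapse (MvPolynomial.X (UVar.x i)) = MvPolynomial.X UVar.y ^ (i - 1) := by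
  simp [collapse]

theorem collapse_UPoly (G : SimpleGraph V) :
    collapse (UPoly G) = (MvPolynomial.X UVar.y + 1) ^ (edges G).card := by
  rw [collapse, aeval_UPoly_twist _ (fun _ => 1) (by simp), ← sum_pow_mul_eq_add_pow]
  simp

theorem sum_edgeWeight (G : SimpleGraph V) : ∑ A ∈ (edges G).powerset, edgeWeight A =
    MvPolynomial.X UVar.y ^ Fintype.card V * UPoly G := by
  rw [UPoly_eq, mul_sum]
  exact sum_congr rfl fun A _ => edgeWeight_eq A

/-- Applying `collapse` to the relation between the differences kills the side of `U`, as the edge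
counts agree, while `connectedSum` is fixed and its coefficient becomes y · y^(|V|-1) ≠ 0. So the
connected sums agree, and the uncollapsed relation gives the claim. -/
theorem IsReconstruction.UPoly_eq {G H : SimpleGraph V} (hV : 3 ≤ Fintype.card V)
    (h : IsReconstruction G H) : UPoly G = UPoly H := by
  have : Nonempty V := Fintype.card_pos_iff.1 (by omega)
  have hy : (MvPolynomial.X UVar.y : MvPolynomial UVar ℤ) ≠ 0 := MvPolynomial.X_ne_zero _
  have h1 := h.sum_edgeWeight_sub
  rw [sum_edgeWeight, sum_edgeWeight, connectedWeight_univ, connectedWeight_univ] at h1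
  have h2 := congrArg collapse h1
  have h3 : ∀ K : SimpleGraph V, collapse (connectedSum K) = connectedSum K := fun K => by
    simp [connectedSum, collapse_X_y]
  simp only [map_sub, map_mul, map_pow, collapse_UPoly, collapse_X_y, collapse_X_x, h3,
    h.card_edges hV, sub_self] at h2
  have h4 : connectedSum G = connectedSum H := by
    refine mul_left_cancel₀ (mul_ne_zero hy (pow_ne_zero (Fintype.card V - 1) hy)) ?_
    linear_combination -h2
  rw [h4, sub_self, sub_eq_zero] at h1
  exact mul_left_cancel₀ (pow_ne_zero _ hy) h1

/-! ### The polynomial ξ as a substitution instance of `U` -/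

/-- The components of `(V, A)` with at least two vertices. -/
noncomputable def bigParts (A : Finset (Sym2 V)) : Finset (Finset V) :=
  (components A).parts.filter fun B => 1 < B.card

theorem mem_bigParts {A : Finset (Sym2 V)} {D : Finset V} :
    D ∈ bigParts A ↔ D ∈ (components A).parts ∧ 1 < D.card := mem_filter

theorem subset_sym2_covered (A : Finset (Sym2 V)) : A ⊆ (covered A).toFinset.sym2 := by
  intro e he
  rw [mem_sym2_iff]
  intro a ha
  exact Set.mem_toFinset.2 ⟨e, he, ha⟩

/-- Containment in `edges G` excludes loops, which would cover a vertex without enlarging its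
component. -/
theorem one_lt_card_part {G : SimpleGraph V} {A : Finset (Sym2 V)} (hA : A ⊆ edges G) {a : V} :
    1 < ((components A).part a).card ↔ a ∈ covered A := by
  constructor
  · intro h
    by_contra ha
    have h1 := part_components_union (S := (covered A).toFinsetᶜ) (A₁ := ∅) (A₂ := A) (by simp)
      (by rw [compl_compl]; exact subset_sym2_covered A) (a := a) (by simpa using ha)
    rw [empty_union, part_components_empty] at h1
    rw [h1, card_singleton] at h
    exact lt_irrefl _ h
  · rintro ⟨e, he, ha⟩
    obtain ⟨b, rfl⟩ := ha
    have hab : a ≠ b := (SimpleGraph.mem_edgeSet G |>.1 (mem_edges.1 (hA he))).ne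
    exact one_lt_card.2 ⟨a, mem_part_self A a, b, mem_part_components.2 (reachable_of_mem he), hab⟩

theorem mem_bigParts_iff {G : SimpleGraph V} {A : Finset (Sym2 V)} (hA : A ⊆ edges G)
    {D : Finset V} : D ∈ bigParts A ↔ ∃ a ∈ covered A, (components A).part a = D := by
  rw [mem_bigParts, mem_parts_components]
  constructor
  · rintro ⟨⟨a, rfl⟩, h⟩
    exact ⟨a, (one_lt_card_part hA).1 h, rfl⟩
  · rintro ⟨a, ha, rfl⟩
    exact ⟨⟨a, rfl⟩, (one_lt_card_part hA).2 ha⟩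

theorem reachable_induce_covered {A : Finset (Sym2 V)} (a b : covered A) :
    ((spanning A).induce (covered A)).Reachable a b ↔ (spanning A).Reachable (a : V) b := by
  constructor
  · exact fun h => h.map (SimpleGraph.Embedding.induce (covered A)).toHom
  · intro h
    rw [SimpleGraph.reachable_iff_reflTransGen] at h
    suffices ∀ c : V, Relation.ReflTransGen (spanning A).Adj a c → ∃ hc : c ∈ covered A,
        ((spanning A).induce (covered A)).Reachable a ⟨c, hc⟩ from (this b h).2
    intro c h
    induction h with
    | refl => exact ⟨a.2, SimpleGraph.Reachable.refl _⟩
    | @tail c d _ hcd ih =>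
      obtain ⟨hc, ih⟩ := ih
      have hd : d ∈ covered A := ⟨_, (spanning_adj.1 hcd).1, Sym2.mem_mk_right c d⟩
      refine ⟨hd, ih.trans (SimpleGraph.Adj.reachable ?_)⟩
      exact hcd

theorem numCovComp_eq {G : SimpleGraph V} {A : Finset (Sym2 V)} (hA : A ⊆ edges G) :
    numCovComp A = (bigParts A).card := by
  rw [← Nat.card_eq_finsetCard, numCovComp]
  refine Nat.card_congr (Equiv.ofBijective (fun D => ⟨SimpleGraph.ConnectedComponent.lift
    (G := (spanning A).induce (covered A)) (fun v => (components A).part v)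
    (fun v w p _ => part_components_eq_iff.2 ((reachable_induce_covered v w).1 ⟨p⟩)) D, ?_⟩)
    ⟨?_, ?_⟩)
  · induction D using SimpleGraph.ConnectedComponent.ind with
    | _ v => exact (mem_bigParts_iff hA).2 ⟨v, v.2, rfl⟩
  · intro D D' h
    induction D using SimpleGraph.ConnectedComponent.ind with
    | _ v =>
      induction D' using SimpleGraph.ConnectedComponent.ind with
      | _ w =>
        exact SimpleGraph.ConnectedComponent.sound ((reachable_induce_covered v w).2
          (part_components_eq_iff.1 (Subtype.ext_iff.1 h)))
  · rintro ⟨D, hD⟩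
    obtain ⟨a, ha, rfl⟩ := (mem_bigParts_iff hA).1 hD
    exact ⟨SimpleGraph.connectedComponentMk _ ⟨a, ha⟩, rfl⟩

/-- The edges of `F` inside the members of `t`. -/
noncomputable def edgesInside (F : Finset (Sym2 V)) (t : Finset (Finset V)) : Finset (Sym2 V) :=
  F.filter fun e => ∃ D ∈ t, e ∈ D.sym2

theorem edgesInside_subset (F : Finset (Sym2 V)) (t : Finset (Finset V)) : edgesInside F t ⊆ F :=
  filter_subset _ _

theorem mk_mem_edgesInside {F : Finset (Sym2 V)} {t : Finset (Finset V)}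
    (ht : t ⊆ (components F).parts) {a b : V} (hF : s(a, b) ∈ F) :
    s(a, b) ∈ edgesInside F t ↔ (components F).part a ∈ t := by
  rw [edgesInside, mem_filter]
  constructor
  · rintro ⟨_, D, hD, h⟩
    rwa [(components F).part_eq_of_mem (ht hD) (mk_mem_sym2_iff.1 h).1]
  · exact fun h => ⟨hF, _, h, mk_mem_sym2_iff.2
      ⟨mem_part_self F a, mem_part_components.2 (reachable_of_mem hF)⟩⟩

theorem disjoint_covered_edgesInside {F : Finset (Sym2 V)} {t : Finset (Finset V)}
    (ht : t ⊆ (components F).parts) :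
    Disjoint (covered (F \ edgesInside F t)) (covered (edgesInside F t)) := by
  rw [Set.disjoint_left]
  rintro a ⟨_, h₁, b, rfl⟩ ⟨_, h₂, c, rfl⟩
  have hF := (mem_sdiff.1 h₁).1
  exact (mem_sdiff.1 h₁).2 ((mk_mem_edgesInside ht hF).2 <| (mk_mem_edgesInside ht (edgesInside_subset F t h₂)).1 h₂)

theorem subset_compl_sym2_covered {A B : Finset (Sym2 V)} (h : Disjoint (covered A) (covered B)) :
    A ⊆ ((covered B).toFinsetᶜ).sym2 := by
  refine (subset_sym2_covered A).trans (sym2_mono fun a ha => ?_)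
  simpa using Set.disjoint_left.1 h (by simpa using ha)

theorem mem_bigParts_iff_of_disjoint {G : SimpleGraph V} {A B : Finset (Sym2 V)}
    (hB : B ⊆ edges G) (h : Disjoint (covered A) (covered B)) {D : Finset V} :
    D ∈ bigParts B ↔ ∃ a ∈ covered B, (components (A ∪ B)).part a = D := by
  rw [mem_bigParts_iff hB, union_comm]
  refine exists_congr fun a => and_congr_right fun ha => ?_
  rw [part_components_union (subset_sym2_covered B) (subset_compl_sym2_covered h) (by simpa using ha)]

theorem bigParts_subset_of_disjoint {G : SimpleGraph V} {A B : Finset (Sym2 V)}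
    (hB : B ⊆ edges G) (h : Disjoint (covered A) (covered B)) :
    bigParts B ⊆ bigParts (A ∪ B) := by
  intro D hD
  obtain ⟨a, ha, rfl⟩ := (mem_bigParts_iff_of_disjoint hB h).1 hD
  exact mem_bigParts.2 ⟨part_mem_components _ a, (mem_bigParts.1 hD).2⟩

theorem bigParts_edgesInside {G : SimpleGraph V} {F : Finset (Sym2 V)} {t : Finset (Finset V)}
    (hF : F ⊆ edges G) (ht : t ⊆ bigParts F) : bigParts (edgesInside F t) = t := by
  have ht' : t ⊆ (components F).parts := ht.trans (filter_subset _ _)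
  have hsub : edgesInside F t ⊆ F := filter_subset _ _
  ext D
  rw [mem_bigParts_iff_of_disjoint (hsub.trans hF) (disjoint_covered_edgesInside ht'),
    sdiff_union_of_subset hsub]
  constructor
  · rintro ⟨a, ⟨_, h, b, rfl⟩, rfl⟩
    exact (mk_mem_edgesInside ht' (hsub h)).1 h
  · intro hD
    obtain ⟨a, ⟨_, he, b, rfl⟩, rfl⟩ := (mem_bigParts_iff hF).1 (ht hD)
    exact ⟨a, ⟨_, (mk_mem_edgesInside ht' he).2 hD, Sym2.mem_mk_left a b⟩, rfl⟩

theorem edgesInside_bigParts {G : SimpleGraph V} {A B : Finset (Sym2 V)}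
    (hB : B ⊆ edges G) (h : Disjoint (covered A) (covered B)) :
    edgesInside (A ∪ B) (bigParts B) = B := by
  have ht := (bigParts_subset_of_disjoint hB h).trans (filter_subset _ _)
  ext z
  induction z using Sym2.ind with
  | _ a b =>
    constructor
    · intro hz
      have hz' : s(a, b) ∈ A ∪ B := filter_subset _ _ hz
      refine (mem_union.1 hz').resolve_left fun hA => ?_
      rw [mk_mem_edgesInside ht hz', mem_bigParts_iff_of_disjoint hB h] at hz
      obtain ⟨c, hc, hca⟩ := hz
      have hcB : c ∈ (covered B).toFinset := by simpa using hc
      have hac := part_components_subset (subset_sym2_covered B) hcB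
      rw [← part_components_union (subset_sym2_covered B) (subset_compl_sym2_covered h) hcB,
        union_comm, hca] at hac
      have haB := hac (mem_part_self _ a)
      exact Set.disjoint_left.1 h ⟨_, hA, Sym2.mem_mk_left a b⟩ (by simpa using haB)
    · intro hz
      have hz' : s(a, b) ∈ A ∪ B := mem_union_right _ hz
      rw [mk_mem_edgesInside ht hz', mem_bigParts_iff_of_disjoint hB h]
      exact ⟨a, ⟨_, hz, Sym2.mem_mk_left a b⟩, rfl⟩

theorem disjoint_of_disjoint_covered {A B : Finset (Sym2 V)}
    (h : Disjoint (covered A) (covered B)) : Disjoint A B := by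
  rw [disjoint_left]
  intro e hA hB
  induction e using Sym2.ind with
  | _ a b =>
    exact Set.disjoint_left.1 h ⟨_, hA, Sym2.mem_mk_left a b⟩ ⟨_, hB, Sym2.mem_mk_left a b⟩

/-- As A and B cover disjoint vertex sets, B consists of the edges of F = A ∪ B inside certain
nontrivial components of F. Marking these components determines B, and every choice of marks occurs.
-/
theorem xiPoly_eq_sum (G : SimpleGraph V) : xiPoly G =
    ∑ F ∈ (edges G).powerset, ∑ t ∈ (bigParts F).powerset,
      MvPolynomial.X 0 ^ (numComp F - t.card) * MvPolynomial.X 1 ^ (F.card - t.card) *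
        MvPolynomial.X 2 ^ t.card := by
  rw [xiPoly, sum_sigma']
  refine sum_bij' (fun p _ => ⟨p.1 ∪ p.2, bigParts p.2⟩)
    (fun q _ => (q.1 \ edgesInside q.1 q.2, edgesInside q.1 q.2)) ?_ ?_ ?_ ?_ ?_
  · rintro ⟨A, B⟩ h
    simp only [mem_filter, mem_product, mem_powerset, mem_sigma] at h ⊢
    exact ⟨union_subset h.1.1 h.1.2, bigParts_subset_of_disjoint h.1.2 h.2⟩
  · rintro ⟨F, t⟩ h
    simp only [mem_filter, mem_product, mem_powerset, mem_sigma] at h ⊢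
    exact ⟨⟨sdiff_subset.trans h.1, (filter_subset _ _).trans h.1⟩,
      disjoint_covered_edgesInside (h.2.trans (filter_subset _ _))⟩
  · rintro ⟨A, B⟩ h
    simp only [mem_filter, mem_product, mem_powerset] at h
    dsimp only
    rw [edgesInside_bigParts h.1.2 h.2,
      union_sdiff_cancel_right (disjoint_of_disjoint_covered h.2)]
  · rintro ⟨F, t⟩ h
    simp only [mem_powerset, mem_sigma] at h
    dsimp only
    rw [bigParts_edgesInside h.1 h.2, sdiff_union_of_subset (edgesInside_subset F t)]
  · rintro ⟨A, B⟩ h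
    simp only [mem_filter, mem_product, mem_powerset] at h
    dsimp only
    rw [numCovComp_eq h.1.2, card_union_of_disjoint (disjoint_of_disjoint_covered h.2)]

/-- The substitution that turns `U` into `ξ`. -/
noncomputable def xiSubst : UVar → MvPolynomial (Fin 3) ℤ
  | UVar.x i => if i ≤ 1 then MvPolynomial.X 0 else
      MvPolynomial.X 2 * MvPolynomial.X 1 ^ (i - 2) + MvPolynomial.X 0 * MvPolynomial.X 1 ^ (i - 1)
  | UVar.y => MvPolynomial.X 1

theorem sum_bigParts_card_sub_one (F : Finset (Sym2 V)) :
    ∑ B ∈ bigParts F, (B.card - 1) + numComp F = Fintype.card V := by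
  rw [← sum_card_sub_one F, bigParts, sum_filter]
  congr 1
  refine sum_congr rfl fun B _ => ?_
  split_ifs <;> omega

theorem xiPoly_eq_aeval (G : SimpleGraph V) :
    xiPoly G = MvPolynomial.aeval xiSubst (UPoly G) := by
  rw [xiPoly_eq_sum, aeval_UPoly]
  refine sum_congr rfl fun F _ => ?_
  have hprod : ∏ B ∈ (components F).parts, xiSubst (UVar.x B.card) =
      (∏ B ∈ bigParts F, (MvPolynomial.X 2 * MvPolynomial.X 1 ^ (B.card - 2) +
        MvPolynomial.X 0 * MvPolynomial.X 1 ^ (B.card - 1))) *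
        MvPolynomial.X 0 ^ (numComp F - (bigParts F).card) := by
    rw [← prod_filter_mul_prod_filter_not _ fun B => 1 < B.card]
    congr 1
    · exact prod_congr rfl fun B hB => by
        rw [xiSubst, if_neg (not_le.2 (mem_filter.1 hB).2)]
    · rw [prod_congr rfl fun B hB => by
        rw [xiSubst, if_pos (not_lt.1 (mem_filter.1 hB).2)], prod_const, numComp_eq]
      congr 1
      rw [bigParts, ← card_filter_add_card_filter_not (s := (components F).parts)
        (fun B => 1 < B.card), Nat.add_sub_cancel_left]
  -- Expanding the product picks z y^(|B|-2) at the marked components t and x y^(|B|-1) at the other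
  -- nontrivial ones; the sum over t matches the marks.
  rw [hprod, prod_add, sum_mul, mul_sum]
  refine sum_congr rfl fun t ht => ?_
  have ht' := mem_powerset.1 ht
  rw [prod_mul_distrib, prod_mul_distrib, prod_const, prod_const, prod_pow_eq_pow_sum,
    prod_pow_eq_pow_sum, card_sdiff_of_subset ht', xiSubst]
  have h1 := card_sub_edgeRank_add F
  have h2 := sum_bigParts_card_sub_one F
  have h3 := sum_sdiff ht' (f := fun B => B.card - 1)
  have h4 : ∑ B ∈ t, (B.card - 1) = ∑ B ∈ t, (B.card - 2) + t.card := by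
    rw [card_eq_sum_ones, ← sum_add_distrib]
    refine sum_congr rfl fun B hB => ?_
    have := (mem_bigParts.1 (ht' hB)).2
    omega
  have h5 := card_le_card ht'
  have h6 : (bigParts F).card ≤ numComp F := by
    rw [numComp_eq]
    exact card_filter_le _ _
  have e0 : numComp F - t.card = ((bigParts F).card - t.card) + (numComp F - (bigParts F).card) := by
    omega
  have e1 : F.card - t.card = (F.card - edgeRank F) + ∑ B ∈ t, (B.card - 2) +
      ∑ B ∈ bigParts F \ t, (B.card - 1) := by
    omega
  rw [e0, e1]
  ring

/-! ### Inclusion-exclusion and the bivariate chromatic polynomial -/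

theorem card_forall_not_eq_sum {Ω ι : Type*} [Finite Ω] (E : Finset ι) (bad : Ω → ι → Prop) :
    (Nat.card {f : Ω // ∀ e ∈ E, ¬ bad f e} : ℤ) =
      ∑ A ∈ E.powerset, (-1) ^ A.card * (Nat.card {f : Ω // ∀ e ∈ A, bad f e} : ℤ) := by
  have := Fintype.ofFinite Ω
  have h1 : ∀ Q : Ω → Prop, (Nat.card {f : Ω // Q f} : ℤ) = ∑ f, if Q f then 1 else 0 := fun Q => by
    rw [Nat.card_eq_fintype_card, Fintype.card_subtype, card_eq_sum_ones, sum_filter]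
    push_cast
    rfl
  simp only [h1, mul_sum]
  rw [sum_comm]
  refine sum_congr rfl fun f _ => ?_
  have h2 : ∑ A ∈ E.powerset, (-1) ^ A.card * (@ite ℤ (∀ e ∈ A, bad f e) (Classical.propDecidable _) 1 0) =
      ∑ A ∈ (E.filter (bad f)).powerset, (-1) ^ A.card := by
    simp only [mul_ite, mul_one, mul_zero]
    rw [← sum_filter]
    refine sum_congr ?_ fun _ _ => rfl
    ext A
    simp only [mem_filter, mem_powerset]
    exact ⟨fun h e he => mem_filter.2 ⟨h.1 he, h.2 e he⟩,
      fun h => ⟨h.trans (filter_subset _ _), fun e he => (mem_filter.1 (h he)).2⟩⟩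
  rw [h2, sum_powerset_neg_one_pow_card]
  simp only [filter_eq_empty_iff]
  congr

/-- The component of `(V, A)` that contains a given vertex. -/
noncomputable def partOf (A : Finset (Sym2 V)) (v : V) : {D // D ∈ (components A).parts} :=
  ⟨(components A).part v, part_mem_components A v⟩

theorem partOf_surjective (A : Finset (Sym2 V)) : Function.Surjective (partOf A) := by
  rintro ⟨D, hD⟩
  obtain ⟨a, rfl⟩ := mem_parts_components.1 hD
  exact ⟨a, rfl⟩

theorem partOf_eq_iff {A : Finset (Sym2 V)} {a b : V} :
    partOf A a = partOf A b ↔ (spanning A).Reachable a b := by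
  rw [Subtype.ext_iff]
  exact part_components_eq_iff

theorem eq_of_reachable {K : Type*} {A : Finset (Sym2 V)} {f : V → K}
    (hf : ∀ e ∈ A, ∃ c, ∀ v ∈ e, f v = c) {a b : V} (h : (spanning A).Reachable a b) :
    f a = f b := by
  rw [SimpleGraph.reachable_iff_reflTransGen] at h
  induction h with
  | refl => rfl
  | @tail c d _ hcd ih =>
    obtain ⟨k, hk⟩ := hf _ (spanning_adj.1 hcd).1
    rw [ih, hk c (Sym2.mem_mk_left c d), hk d (Sym2.mem_mk_right c d)]

/-- A map constant on every edge of A is constant on components, so it factors uniquely through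
them. -/
theorem card_monochromatic {K : Type*} (A : Finset (Sym2 V)) (Q : (V → K) → Prop)
    (hQ : ∀ f, Q f → ∀ e ∈ A, ∃ c, ∀ v ∈ e, f v = c) :
    Nat.card {f // Q f} = Nat.card {g : {D // D ∈ (components A).parts} → K // Q (g ∘ partOf A)} := by
  refine (Nat.card_congr (Equiv.ofBijective (fun g => ⟨g.1 ∘ partOf A, g.2⟩) ⟨?_, ?_⟩)).symm
  · intro g g' h
    exact Subtype.ext ((partOf_surjective A).injective_comp_right (Subtype.ext_iff.1 h))
  · rintro ⟨f, hf⟩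
    have hfac : (fun D => f (Function.surjInv (partOf_surjective A) D)) ∘ partOf A = f := by
      funext v
      exact eq_of_reachable (hQ f hf)
        (partOf_eq_iff.1 (Function.surjInv_eq (partOf_surjective A) (partOf A v)))
    exact ⟨⟨_, by rwa [hfac]⟩, Subtype.ext hfac⟩

/-- A singleton component may take any of the p colours; a larger one contains an edge, so its
common colour is among the first q. -/
theorem card_monochromatic_lt {G : SimpleGraph V} {A : Finset (Sym2 V)} (hA : A ⊆ edges G)
    {p q : ℕ} (hqp : q ≤ p) :
    Nat.card {f : V → Fin p // ∀ e ∈ A, ∃ c : Fin p, (c : ℕ) < q ∧ ∀ v ∈ e, f v = c} =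
      ∏ B ∈ (components A).parts, if B.card ≤ 1 then p else q := by
  rw [card_monochromatic A _ fun f hf e he => (hf e he).imp fun _ h => h.2]
  have h1 : ∀ g : {D // D ∈ (components A).parts} → Fin p,
      (∀ e ∈ A, ∃ c : Fin p, (c : ℕ) < q ∧ ∀ v ∈ e, (g ∘ partOf A) v = c) ↔
        g ∈ Fintype.piFinset fun D => if D.1.card ≤ 1 then univ else
          univ.filter fun c : Fin p => (c : ℕ) < q := fun g => by
    rw [Fintype.mem_piFinset]
    constructor
    · rintro h ⟨D, hD⟩
      split_ifs with hc
      · exact mem_univ _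
      · obtain ⟨a, ⟨e, he, hae⟩, rfl⟩ :=
          (mem_bigParts_iff hA).1 (mem_bigParts.2 ⟨hD, not_le.1 hc⟩)
        obtain ⟨c, hcq, hc⟩ := h e he
        have := hc a hae
        simp only [Function.comp_apply, partOf] at this
        simpa [this] using hcq
    · intro h e he
      induction e using Sym2.ind with
      | _ a b =>
        have hbig := (one_lt_card_part hA).2 ⟨_, he, Sym2.mem_mk_left a b⟩
        have ha := h (partOf A a)
        rw [if_neg (show ¬ (partOf A a).1.card ≤ 1 from not_le.2 hbig)] at ha
        refine ⟨g (partOf A a), (mem_filter.1 ha).2, fun v hv => ?_⟩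
        rcases Sym2.mem_iff.1 hv with rfl | rfl
        · rfl
        · exact congrArg g (partOf_eq_iff.2 (reachable_of_mem he).symm)
  rw [Nat.card_congr (Equiv.subtypeEquivRight h1), Nat.card_eq_finsetCard, Fintype.card_piFinset,
    ← prod_coe_sort (components A).parts]
  refine prod_congr rfl fun D _ => ?_
  split_ifs
  · simp
  · rw [Fin.card_filter_val_lt, min_eq_right hqp]

theorem card_genColoring (G : SimpleGraph V) {p q : ℕ} (hqp : q ≤ p) :
    (Nat.card (GenColoring G p q) : ℤ) = ∑ A ∈ (edges G).powerset,
      (-1) ^ A.card * ∏ B ∈ (components A).parts, if B.card ≤ 1 then (p : ℤ) else q := by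
  have h1 : ∀ f : V → Fin p,
      (∀ u v, G.Adj u v → (f u : ℕ) < q → (f v : ℕ) < q → f u ≠ f v) ↔
        ∀ e ∈ edges G, ¬ ∃ c : Fin p, (c : ℕ) < q ∧ ∀ v ∈ e, f v = c := fun f => by
    constructor
    · rintro h e he ⟨c, hc, hce⟩
      induction e using Sym2.ind with
      | _ a b =>
        have ha := hce a (Sym2.mem_mk_left a b)
        have hb := hce b (Sym2.mem_mk_right a b)
        exact h a b (mem_edges.1 he) (by rwa [ha]) (by rwa [hb]) (ha.trans hb.symm)
    · intro h a b hab ha hb heq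
      refine h s(a, b) (mem_edges.2 hab) ⟨f a, ha, fun v hv => ?_⟩
      rcases Sym2.mem_iff.1 hv with rfl | rfl
      · rfl
      · exact heq.symm
  rw [GenColoring, Nat.card_congr (Equiv.subtypeEquivRight h1), card_forall_not_eq_sum]
  refine sum_congr rfl fun A hA => ?_
  rw [card_monochromatic_lt (mem_powerset.1 hA) hqp]
  push_cast
  rfl

/-- The bivariate chromatic polynomial as an evaluation of `ξ`. -/
noncomputable def xiBivariate (G : SimpleGraph V) : MvPolynomial (Fin 2) ℤ :=
  MvPolynomial.aeval ![MvPolynomial.X 0, -1, MvPolynomial.X 0 - MvPolynomial.X 1] (xiPoly G)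

theorem isBivariateChromatic_xiBivariate (G : SimpleGraph V) :
    IsBivariateChromatic G (xiBivariate G) := by
  intro p q hqp
  have h1 : MvPolynomial.eval ![(p : ℤ), (q : ℤ)] (xiBivariate G) =
      MvPolynomial.aeval (fun i => MvPolynomial.aeval ![(p : ℤ), -1, (p : ℤ) - q] (xiSubst i))
        (UPoly G) := by
    rw [xiBivariate, xiPoly_eq_aeval, ← MvPolynomial.coe_aeval_eq_eval, RingHom.coe_coe,
      ← AlgHom.comp_apply, ← AlgHom.comp_apply]
    congr 1
    ext i
    cases i with
    | x i =>
      simp only [AlgHom.coe_comp, Function.comp_apply, MvPolynomial.aeval_X, xiSubst]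
      split_ifs <;> simp
    | y => simp [xiSubst]
  rw [h1, card_genColoring G hqp, aeval_UPoly_twist _ fun i => if i ≤ 1 then (p : ℤ) else q]
  · simp [xiSubst]
  · intro i hi
    simp only [xiSubst]
    split_ifs with h
    · obtain rfl : i = 1 := by omega
      simp
    · obtain ⟨j, rfl⟩ : ∃ j, i = j + 2 := ⟨i - 2, by omega⟩
      -- For i ≥ 2 this is (p - q)(-1)^(i-2) + p(-1)^(i-1) = (-1)^(i-1) q.
      simp [pow_succ]
      ring

/-- The invertible substitution x ↦ x + y carries the region q ≤ p to the full grid of pairs of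
naturals, and a polynomial is determined by its values on a product of infinite sets. -/
theorem IsBivariateChromatic.unique {G : SimpleGraph V} {P P' : MvPolynomial (Fin 2) ℤ}
    (h : IsBivariateChromatic G P) (h' : IsBivariateChromatic G P') : P = P' := by
  let φ : MvPolynomial (Fin 2) ℤ →ₐ[ℤ] MvPolynomial (Fin 2) ℤ :=
    MvPolynomial.aeval ![MvPolynomial.X 0 + MvPolynomial.X 1, MvPolynomial.X 1]
  let ψ : MvPolynomial (Fin 2) ℤ →ₐ[ℤ] MvPolynomial (Fin 2) ℤ :=
    MvPolynomial.aeval ![MvPolynomial.X 0 - MvPolynomial.X 1, MvPolynomial.X 1]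
  have hψφ : ψ.comp φ = AlgHom.id ℤ _ := by
    ext i
    fin_cases i <;> simp [φ, ψ]
  have hinj : Function.Injective φ := fun a b hab => by
    have := congrArg ψ hab
    rwa [← AlgHom.comp_apply, ← AlgHom.comp_apply, hψφ] at this
  refine hinj (MvPolynomial.funext_set (fun _ => Set.range ((↑) : ℕ → ℤ))
    (fun _ => Set.infinite_range_of_injective Nat.cast_injective) fun x hx => ?_)
  obtain ⟨d, hd⟩ := hx 0 (Set.mem_univ _)
  obtain ⟨q, hq⟩ := hx 1 (Set.mem_univ _)
  have key : ∀ p, MvPolynomial.eval x (φ p) =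
      MvPolynomial.eval ![((d + q : ℕ) : ℤ), (q : ℤ)] p := fun p => by
    rw [← MvPolynomial.coe_aeval_eq_eval, ← MvPolynomial.coe_aeval_eq_eval, RingHom.coe_coe,
      RingHom.coe_coe, ← AlgHom.comp_apply]
    congr 1
    ext i
    fin_cases i <;> simp [φ, ← hd, ← hq]
  rw [key, key, h _ _ (Nat.le_add_left q d), h' _ _ (Nat.le_add_left q d)]

theorem isBivariateChromatic_bivariateChromatic (G : SimpleGraph V) :
    IsBivariateChromatic G (bivariateChromatic G) :=
  Classical.epsilon_spec (p := IsBivariateChromatic G) ⟨_, isBivariateChromatic_xiBivariate G⟩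

theorem bivariateChromatic_eq (G : SimpleGraph V) : bivariateChromatic G = xiBivariate G :=
  (isBivariateChromatic_bivariateChromatic G).unique (isBivariateChromatic_xiBivariate G)

/-! ### Stanley's chromatic symmetric function -/

/-- Expanding the product chooses one variable for each i. A nonzero exponent is needed for the
chosen variable to be recoverable from its power. -/
theorem coeff_prod_powerSum {ι : Type*} [Fintype ι] (n : ι → ℕ) (hn : ∀ i, n i ≠ 0) (m : ℕ →₀ ℕ) :
    MvPowerSeries.coeff m (∏ i, powerSum (n i)) =
      (Nat.card {g : ι → ℕ // ∑ i, Finsupp.single (g i) (n i) = m} : ℤ) := by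
  have h1 : ∀ i (l : ℕ →₀ ℕ), MvPowerSeries.coeff l (powerSum (n i)) =
      if ∃ j, l = Finsupp.single j (n i) then 1 else 0 := fun i l => rfl
  rw [MvPowerSeries.coeff_prod]
  simp only [h1, prod_boole, mem_univ, forall_true_left]
  rw [← sum_filter, sum_const, nsmul_one]
  suffices key : ∀ T : Finset (ι →₀ ℕ →₀ ℕ),
      (∀ l, l ∈ T ↔ ∑ i, l i = m ∧ ∀ i, ∃ j, l i = Finsupp.single j (n i)) →
      T.card = Nat.card {g : ι → ℕ // ∑ i, Finsupp.single (g i) (n i) = m} from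
    congrArg Nat.cast (key _ fun l => by
      rw [mem_filter, mem_finsuppAntidiag, and_iff_left (subset_univ _)])
  intro T hmem
  rw [← Nat.card_eq_finsetCard]
  let Φ : {g : ι → ℕ // ∑ i, Finsupp.single (g i) (n i) = m} → T := fun g =>
    ⟨Finsupp.equivFunOnFinite.symm fun i => Finsupp.single (g.1 i) (n i),
      (hmem _).2 ⟨by simpa using g.2, fun i => ⟨g.1 i, rfl⟩⟩⟩
  refine (Nat.card_congr (Equiv.ofBijective Φ ⟨fun g g' h => ?_, ?_⟩)).symm
  · refine Subtype.ext (funext fun i => ?_)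
    exact Finsupp.single_left_injective (hn i) (DFunLike.congr_fun (Subtype.ext_iff.1 h) i)
  · rintro ⟨l, hl⟩
    choose g hg using ((hmem l).1 hl).2
    refine ⟨⟨g, ?_⟩, Subtype.ext (Finsupp.ext fun i => (hg i).symm)⟩
    rw [← ((hmem l).1 hl).1]
    exact sum_congr rfl fun i _ => (hg i).symm

/-- There are infinitely many colours, so inclusion-exclusion is applied separately to each
monomial, where only finitely many colourings occur. -/
theorem finite_monomial_fiber (m : ℕ →₀ ℕ) :
    Finite {f : V → ℕ // ∑ v, Finsupp.single (f v) 1 = m} := by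
  have h1 : ∀ f : {f : V → ℕ // ∑ v, Finsupp.single (f v) 1 = m}, ∀ v, f.1 v ∈ m.support := by
    rintro ⟨f, rfl⟩ v
    rw [Finsupp.mem_support_iff, Finsupp.finsetSum_apply]
    exact (sum_pos' (fun _ _ => Nat.zero_le _) ⟨v, mem_univ v, by simp⟩).ne'
  refine Finite.of_injective (β := V → m.support) (fun f v => ⟨f.1 v, h1 f v⟩) fun f f' h => ?_
  exact Subtype.ext (funext fun v => Subtype.ext_iff.1 (congrFun h v))

theorem sum_single_partOf (A : Finset (Sym2 V)) (g : {D // D ∈ (components A).parts} → ℕ) :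
    ∑ v, Finsupp.single (g (partOf A v)) 1 = ∑ D, Finsupp.single (g D) D.1.card := by
  rw [← sum_fiberwise (s := univ) (g := partOf A)]
  refine sum_congr rfl fun D _ => ?_
  rw [sum_congr rfl fun v hv => by rw [(mem_filter.1 hv).2], sum_const, Finsupp.smul_single]
  congr 1
  rw [smul_eq_mul, mul_one]
  congr 1
  obtain ⟨a, rfl⟩ := partOf_surjective A D
  ext v
  simp only [mem_filter, mem_univ, true_and, partOf_eq_iff]
  exact SimpleGraph.reachable_comm.trans mem_part_components.symm

theorem card_monochromatic_monomial (A : Finset (Sym2 V)) (m : ℕ →₀ ℕ) :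
    (Nat.card {f : {f : V → ℕ // ∑ v, Finsupp.single (f v) 1 = m} //
      ∀ e ∈ A, ∃ c, ∀ v ∈ e, f.1 v = c} : ℤ) =
      MvPowerSeries.coeff m (∏ B ∈ (components A).parts, powerSum B.card) := by
  rw [← prod_coe_sort (components A).parts, coeff_prod_powerSum _ fun D =>
    (card_pos.2 ((components A).nonempty_of_mem_parts D.2)).ne', Nat.cast_inj,
    Nat.card_congr (Equiv.subtypeSubtypeEquivSubtypeInter
      (fun f : V → ℕ => ∑ v, Finsupp.single (f v) 1 = m)
      fun f => ∀ e ∈ A, ∃ c, ∀ v ∈ e, f v = c),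
    card_monochromatic A _ fun f hf => hf.2]
  refine Nat.card_congr (Equiv.subtypeEquivRight fun g => ?_)
  rw [← sum_single_partOf]
  refine and_iff_left fun e he => ?_
  induction e using Sym2.ind with
  | _ a b =>
    refine ⟨g (partOf A a), fun v hv => ?_⟩
    rcases Sym2.mem_iff.1 hv with rfl | rfl
    · rfl
    · exact congrArg g (partOf_eq_iff.2 (reachable_of_mem he).symm)

theorem card_coloring_monomial (G : SimpleGraph V) (m : ℕ →₀ ℕ) :
    Nat.card {κ : G.Coloring ℕ // ∑ v, Finsupp.single (κ v) 1 = m} =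
      Nat.card {f : {f : V → ℕ // ∑ v, Finsupp.single (f v) 1 = m} //
        ∀ e ∈ edges G, ¬ ∃ c, ∀ v ∈ e, f.1 v = c} := by
  refine Nat.card_congr
    { toFun := fun κ => ⟨⟨κ.1, κ.2⟩, ?_⟩
      invFun := fun f => ⟨SimpleGraph.Coloring.mk f.1.1 fun {a b} hab heq => ?_, f.1.2⟩
      left_inv := fun κ => rfl
      right_inv := fun f => rfl }
  · rintro e he ⟨c, hc⟩
    induction e using Sym2.ind with
    | _ a b =>
      exact κ.1.valid (show G.Adj a b from mem_edges.1 he)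
        ((hc a (Sym2.mem_mk_left a b)).trans (hc b (Sym2.mem_mk_right a b)).symm)
  · refine absurd ?_ (f.2 s(a, b) (mem_edges.2 hab))
    refine ⟨f.1.1 a, fun v hv => ?_⟩
    rcases Sym2.mem_iff.1 hv with rfl | rfl
    · rfl
    · exact heq.symm

theorem chromaticSymm_eq (G : SimpleGraph V) :
    chromaticSymm G = MvPolynomial.aeval stanleySubst (UPoly G) := by
  rw [aeval_UPoly_twist _ powerSum]
  · ext m
    have := finite_monomial_fiber (V := V) m
    change (Nat.card {κ : G.Coloring ℕ // ∑ v, Finsupp.single (κ v) 1 = m} : ℤ) = _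
    rw [card_coloring_monomial, card_forall_not_eq_sum, map_sum]
    refine sum_congr rfl fun A _ => ?_
    have h1 : stanleySubst UVar.y ^ A.card = MvPowerSeries.C ((-1 : ℤ) ^ A.card) := by
      simp [stanleySubst]
    rw [card_monochromatic_monomial, h1, MvPowerSeries.coeff_C_mul]
  · intro i hi
    obtain ⟨j, rfl⟩ : ∃ j, i = j + 1 := ⟨i - 1, by omega⟩
    simp [stanleySubst, pow_succ]

/-! ### Coarsenings of partitions and the polychromate -/

theorem Finpartition.univ_part_eq_iff {α : Type*} [Fintype α] (π : Finpartition (univ : Finset α))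
    {a b : α} : π.part a = π.part b ↔ b ∈ π.part a := by
  rw [π.mem_part_iff_part_eq_part (mem_univ _) (mem_univ _)]
  exact eq_comm

theorem Finpartition.univ_ext {α : Type*} [Fintype α] {π π' : Finpartition (univ : Finset α)}
    (h : ∀ a b, π.part a = π.part b ↔ π'.part a = π'.part b) : π = π' := by
  have h1 : ∀ a, π.part a = π'.part a := fun a => by
    ext b
    rw [← Finpartition.univ_part_eq_iff, h, Finpartition.univ_part_eq_iff]
  have h2 : ∀ ρ : Finpartition (univ : Finset α), ρ.parts = univ.image ρ.part := fun ρ => by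
    ext B
    simp only [mem_image, mem_univ, true_and]
    constructor
    · intro hB
      obtain ⟨a, ha⟩ := ρ.nonempty_of_mem_parts hB
      exact ⟨a, ρ.part_eq_of_mem hB ha⟩
    · rintro ⟨a, rfl⟩
      exact ρ.part_mem.2 (mem_univ a)
  refine Finpartition.ext ?_
  rw [h2, h2]
  exact image_congr fun a _ => h1 a

/-- The partition of `α` into the preimages of the parts of `ρ`. -/
noncomputable def Finpartition.pullback {α β : Type*} [Fintype α] [Fintype β] (p : α → β)
    (ρ : Finpartition (univ : Finset β)) : Finpartition (univ : Finset α) :=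
  Finpartition.ofSetoid (Setoid.ker (ρ.part ∘ p))

theorem Finpartition.part_pullback_eq_iff {α β : Type*} [Fintype α] [Fintype β] {p : α → β}
    {ρ : Finpartition (univ : Finset β)} {a b : α} :
    (ρ.pullback p).part a = (ρ.pullback p).part b ↔ ρ.part (p a) = ρ.part (p b) := by
  rw [Finpartition.univ_part_eq_iff]
  exact Finpartition.mem_part_ofSetoid_iff_rel

theorem Finpartition.part_pullback {α β : Type*} [Fintype α] [Fintype β] (p : α → β)
    (ρ : Finpartition (univ : Finset β)) (a : α) :
    (ρ.pullback p).part a = univ.filter fun b => p b ∈ ρ.part (p a) := by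
  ext b
  rw [← Finpartition.univ_part_eq_iff, Finpartition.part_pullback_eq_iff,
    Finpartition.univ_part_eq_iff]
  simp

/-- The sum over all partitions of the index set of a family of positive integers `n i`, each
partition contributing the product of the variables indexed by the sums over its parts. -/
noncomputable def mergeSum {ι : Type*} [Fintype ι] (n : ι → ℕ) : MvPolynomial UVar ℤ :=
  ∑ ρ : Finpartition (univ : Finset ι), ∏ C ∈ ρ.parts, MvPolynomial.X (UVar.x (∑ i ∈ C, n i))

/-- The fibers of `p` lie inside the parts of `π`. -/
def Finpartition.Respects {α β : Type*} [Fintype α] (p : α → β)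
    (π : Finpartition (univ : Finset α)) : Prop :=
  ∀ a b, p a = p b → π.part a = π.part b

/-- Partitions whose blocks are unions of fibres are exactly the pullbacks of partitions of β, and
the weight of a pulled-back block is the sum of n over the original block. -/
theorem sum_finpartition_of_fiber {α β : Type*} [Fintype α] [Fintype β] {p : α → β}
    (hp : Function.Surjective p) (w : α → ℕ) (n : β → ℕ)
    (hn : ∀ i, ∑ a with p a = i, w a = n i) :
    ∑ π : Finpartition (univ : Finset α) with π.Respects p,
      ∏ B ∈ π.parts, MvPolynomial.X (R := ℤ) (UVar.x (∑ a ∈ B, w a)) = mergeSum n := by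
  have hs := Function.surjInv_eq hp
  symm
  refine sum_bij' (fun ρ _ => ρ.pullback p) (fun π _ => π.pullback (Function.surjInv hp))
    ?_ ?_ ?_ ?_ ?_
  · intro ρ _
    rw [mem_filter]
    refine ⟨mem_univ _, fun a b hab => ?_⟩
    rw [Finpartition.part_pullback_eq_iff, hab]
  · exact fun _ _ => mem_univ _
  · intro ρ _
    refine Finpartition.univ_ext fun a b => ?_
    rw [Finpartition.part_pullback_eq_iff, Finpartition.part_pullback_eq_iff, hs, hs]
  · intro π hπ
    refine Finpartition.univ_ext fun a b => ?_
    have h1 := (mem_filter.1 hπ).2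
    rw [Finpartition.part_pullback_eq_iff, Finpartition.part_pullback_eq_iff,
      h1 _ _ (hs (p a)), h1 _ _ (hs (p b))]
  · intro ρ _
    refine prod_bij (fun C _ => univ.filter fun a => p a ∈ C) ?_ ?_ ?_ ?_
    · intro C hC
      obtain ⟨i, hi⟩ := ρ.nonempty_of_mem_parts hC
      obtain ⟨a, rfl⟩ := hp i
      rw [← ρ.part_eq_of_mem hC hi, ← Finpartition.part_pullback]
      exact Finpartition.part_mem _ |>.2 (mem_univ a)
    · intro C _ C' _ h
      ext i
      obtain ⟨a, rfl⟩ := hp i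
      simpa using congrArg (a ∈ ·) h
    · intro B hB
      obtain ⟨a, ha⟩ := (ρ.pullback p).nonempty_of_mem_parts hB
      refine ⟨ρ.part (p a), ρ.part_mem.2 (mem_univ _), ?_⟩
      rw [← Finpartition.part_pullback, Finpartition.part_eq_of_mem _ hB ha]
    · intro C _
      congr 2
      simp only [← hn]
      rw [← sum_fiberwise_of_maps_to (s := univ.filter fun a => p a ∈ C) (t := C) (g := p)
        fun a ha => (mem_filter.1 ha).2]
      refine sum_congr rfl fun i hi => sum_congr ?_ fun _ _ => rfl
      ext a
      simp only [mem_filter, mem_univ, true_and]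
      exact ⟨fun h => ⟨h ▸ hi, h⟩, fun h => h.2⟩

theorem mergeSum_comp_equiv {ι κ : Type*} [Fintype ι] [Fintype κ] (e : ι ≃ κ) (n : κ → ℕ) :
    mergeSum (n ∘ e) = mergeSum n := by
  rw [← sum_finpartition_of_fiber e.surjective (n ∘ e) n fun i => ?_, mergeSum, filter_true_of_mem]
  · intro π _ a b hab
    rw [e.injective hab]
  · rw [sum_eq_single (e.symm i)]
    · simp
    · intro a ha hne
      exact absurd (e.eq_symm_apply.2 (mem_filter.1 ha).2) hne
    · simp

theorem exists_equiv_of_map_univ_eq {ι κ γ : Type*} [Fintype ι] [Fintype κ] {n : ι → γ} {m : κ → γ}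
    (h : (univ : Finset ι).val.map n = (univ : Finset κ).val.map m) : ∃ e : ι ≃ κ, m ∘ e = n := by
  have h1 : ∀ c, Nonempty ({i // n i = c} ≃ {j // m j = c}) := fun c => by
    have h2 := congrArg (Multiset.count c) h
    rw [Multiset.count_map, Multiset.count_map] at h2
    refine Fintype.card_eq.1 ?_
    rw [Fintype.card_subtype, Fintype.card_subtype]
    simp only [eq_comm (b := c)]
    exact h2
  exact ⟨Equiv.ofFiberEquiv fun c => (h1 c).some, funext fun i => Equiv.ofFiberEquiv_map _ i⟩

/-- `mergeSum` of the family of members of a multiset. -/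
noncomputable def multisetMergeSum (M : Multiset ℕ) : MvPolynomial UVar ℤ :=
  mergeSum fun i : M.ToType => (i.1 : ℕ)

/-- Dependence on the multiset of sizes alone allows `mergeSum` to be read off from a monomial, as
the linear map requires. -/
theorem multisetMergeSum_map {ι : Type*} [Fintype ι] (n : ι → ℕ) :
    multisetMergeSum ((univ : Finset ι).val.map n) = mergeSum n := by
  obtain ⟨e, he⟩ := exists_equiv_of_map_univ_eq (n := n)
    (m := fun i : ((univ : Finset ι).val.map n).ToType => (i.1 : ℕ)) (Multiset.map_univ_coe _).symm
  rw [multisetMergeSum, ← mergeSum_comp_equiv e, he]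

/-- The indices `i` of the variables `x i` in a monomial, with multiplicity. -/
noncomputable def partSizes (d : UVar →₀ ℕ) : Multiset ℕ :=
  (Finsupp.toMultiset d).filterMap fun
    | UVar.x i => some i
    | UVar.y => none

theorem partSizes_add (d d' : UVar →₀ ℕ) : partSizes (d + d') = partSizes d + partSizes d' := by
  rw [partSizes, map_add, Multiset.filterMap_add]
  rfl

theorem partSizes_single_y (a : ℕ) : partSizes (Finsupp.single UVar.y a) = 0 := by
  induction a with
  | zero => simp [partSizes]
  | succ a ih =>
    rw [Finsupp.single_add, partSizes_add, ih, partSizes,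
      Finsupp.toMultiset_single, one_nsmul, zero_add]
    exact Multiset.filterMap_cons_none _ _ rfl

theorem partSizes_single_x (i : ℕ) : partSizes (Finsupp.single (UVar.x i) 1) = {i} := by
  rw [partSizes, Finsupp.toMultiset_single, one_nsmul]
  exact Multiset.filterMap_cons_some _ _ _ rfl

theorem partSizes_sum {ι : Type*} (s : Finset ι) (n : ι → ℕ) :
    partSizes (∑ i ∈ s, Finsupp.single (UVar.x (n i)) 1) = s.val.map n := by
  induction s using Finset.induction_on with
  | empty => simp [partSizes]
  | insert i s hi ih =>
    rw [sum_insert hi, partSizes_add, ih, partSizes_single_x, insert_val_of_notMem hi,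
      Multiset.map_cons, Multiset.singleton_add]

/-- The linear map that takes the `U`-polynomial to the polychromate. -/
noncomputable def polychromateMap : MvPolynomial UVar ℤ →ₗ[ℤ] MvPolynomial UVar ℤ :=
  (MvPolynomial.basisMonomials UVar ℤ).constr ℤ fun d =>
    (MvPolynomial.X UVar.y - 1) ^ (d UVar.y + (partSizes d).sum - (partSizes d).card) *
      multisetMergeSum (partSizes d)

theorem polychromateMap_apply {ι : Type*} (s : Finset ι) (n : ι → ℕ) (a : ℕ) :
    polychromateMap (MvPolynomial.X UVar.y ^ a * ∏ i ∈ s, MvPolynomial.X (UVar.x (n i))) =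
      (MvPolynomial.X UVar.y - 1) ^ (a + ∑ i ∈ s, n i - s.card) *
        multisetMergeSum (s.val.map n) := by
  set d : UVar →₀ ℕ := Finsupp.single UVar.y a + ∑ i ∈ s, Finsupp.single (UVar.x (n i)) 1
  have hd : MvPolynomial.X UVar.y ^ a * ∏ i ∈ s, MvPolynomial.X (UVar.x (n i)) =
      MvPolynomial.basisMonomials UVar ℤ d := by
    rw [MvPolynomial.coe_basisMonomials, MvPolynomial.X_pow_eq_monomial]
    simp only [MvPolynomial.X]
    rw [← MvPolynomial.monomial_sum_one, MvPolynomial.monomial_mul, one_mul]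
  have hy : d UVar.y = a := by simp [d]
  have hsizes : partSizes d = s.val.map n := by
    rw [partSizes_add, partSizes_single_y, partSizes_sum, zero_add]
  rw [hd, polychromateMap, Module.Basis.constr_basis, hy, hsizes, Multiset.card_map]
  rfl

/-- In the monomial of A, the indices of the x-variables sum to |V| and their number is k(A), so the
exponent of y - 1 is |A| - r(A) + |V| - k(A) = |A|. -/
theorem polychromateMap_UPoly (G : SimpleGraph V) :
    polychromateMap (UPoly G) = ∑ A ∈ (edges G).powerset, (MvPolynomial.X UVar.y - 1) ^ A.card *
      mergeSum fun D : {D // D ∈ (components A).parts} => D.1.card := by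
  rw [UPoly_eq, map_sum]
  refine sum_congr rfl fun A _ => ?_
  rw [polychromateMap_apply, (components A).sum_card_parts, card_univ, card_sub_edgeRank_add,
    numComp_eq, Nat.add_sub_cancel, ← multisetMergeSum_map]
  congr 2
  exact (Multiset.attach_map_val' _ _).symm

/-- All edges of A lie inside blocks of π exactly when each block is a union of components of A. -/
theorem mergeSum_components (A : Finset (Sym2 V)) :
    mergeSum (fun D : {D // D ∈ (components A).parts} => D.1.card) =
      ∑ π : Finpartition (univ : Finset V) with ∀ e ∈ A, ∃ B ∈ π.parts, ∀ v ∈ e, v ∈ B,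
        ∏ B ∈ π.parts, MvPolynomial.X (UVar.x B.card) := by
  rw [← sum_finpartition_of_fiber (partOf_surjective A) (fun _ => 1) _ fun D => ?_]
  · simp only [sum_const, smul_eq_mul, mul_one]
    refine sum_congr ?_ fun π _ => rfl
    ext π
    rw [mem_filter, mem_filter]
    refine and_congr_right fun _ => ?_
    constructor
    · intro h e he
      induction e using Sym2.ind with
      | _ a b =>
        refine ⟨π.part a, π.part_mem.2 (mem_univ a), fun v hv => ?_⟩
        rcases Sym2.mem_iff.1 hv with rfl | rfl
        · exact π.mem_part (mem_univ _)
        · exact π.univ_part_eq_iff.1 (h _ _ (partOf_eq_iff.2 (reachable_of_mem he)))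
    · intro h a b hab
      refine eq_of_reachable (f := π.part) (fun e he => ?_) (partOf_eq_iff.1 hab)
      obtain ⟨B, hB, hBe⟩ := h e he
      exact ⟨B, fun v hv => π.part_eq_of_mem hB (hBe v hv)⟩
  · rw [← card_eq_sum_ones]
    congr 1
    obtain ⟨a, rfl⟩ := partOf_surjective A D
    ext v
    simp only [mem_filter, mem_univ, true_and, partOf_eq_iff]
    exact SimpleGraph.reachable_comm.trans mem_part_components.symm

theorem polychromate_eq (G : SimpleGraph V) : polychromate G = polychromateMap (UPoly G) := by
  rw [polychromateMap_UPoly, polychromate]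
  simp only [mergeSum_components, sum_filter, mul_sum]
  rw [sum_comm]
  refine sum_congr rfl fun π _ => ?_
  -- Binomial expansion of y^e(π) = ((y - 1) + 1)^e(π) over the subsets of the edges inside blocks.
  have h1 := sum_pow_mul_eq_add_pow (MvPolynomial.X UVar.y - 1 : MvPolynomial UVar ℤ) 1
    ((edges G).filter fun e => ∃ B ∈ π.parts, ∀ v ∈ e, v ∈ B)
  rw [sub_add_cancel] at h1
  rw [← h1, sum_mul]
  simp only [mul_ite, mul_zero, one_pow, mul_one]
  rw [← sum_filter]
  refine sum_congr ?_ fun _ _ => rfl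
  ext A
  simp only [mem_filter, mem_powerset]
  exact ⟨fun h => ⟨h.trans (filter_subset _ _), fun e he => (mem_filter.1 (h he)).2⟩,
    fun h e he => mem_filter.2 ⟨h.1 he, h.2 e he⟩⟩

end

theorem mainTheorem5 :
    -- the polynomials
    IsReconstructible.{u} (fun V _ G => UPoly G) ∧
    IsReconstructible.{u} (fun V _ G => xiPoly G) ∧
    -- all their evaluations
    (∀ (R : Type w) [CommRing R] (a : UVar → R),
      IsReconstructible.{u} (fun V _ G => MvPolynomial.aeval a (UPoly G))) ∧
    (∀ (R : Type w) [CommRing R] (a : Fin 3 → R),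
      IsReconstructible.{u} (fun V _ G => MvPolynomial.aeval a (xiPoly G))) ∧
    -- the bivariate chromatic polynomial
    (∀ (V : Type u) [Fintype V] (G : SimpleGraph V),
      IsBivariateChromatic G (bivariateChromatic G) ∧
      bivariateChromatic G =
        MvPolynomial.aeval ![MvPolynomial.X 0, -1, MvPolynomial.X 0 - MvPolynomial.X 1]
          (xiPoly G)) ∧
    IsReconstructible.{u} (fun V _ G => bivariateChromatic G) ∧
    -- the chromatic symmetric function
    (∀ (V : Type u) [Fintype V] (G : SimpleGraph V),
      chromaticSymm G = MvPolynomial.aeval stanleySubst (UPoly G)) ∧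
    IsReconstructible.{u} (fun V _ G => chromaticSymm G) ∧
    -- the polychromate
    (∃ L : MvPolynomial UVar ℤ →ₗ[ℤ] MvPolynomial UVar ℤ,
      ∀ (V : Type u) [Fintype V] (G : SimpleGraph V), polychromate G = L (UPoly G)) ∧
    IsReconstructible.{u} (fun V _ G => polychromate G) := by
  refine ⟨fun _ _ hV G H h => h.UPoly_eq hV, fun _ _ hV G H h => ?_,
    fun R _ a _ _ hV G H h => ?_, fun R _ a _ _ hV G H h => ?_,
    fun _ _ G => ⟨isBivariateChromatic_bivariateChromatic G, bivariateChromatic_eq G⟩,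
    fun _ _ hV G H h => ?_, fun _ _ G => chromaticSymm_eq G, fun _ _ hV G H h => ?_,
    ⟨polychromateMap, fun _ _ G => polychromate_eq G⟩, fun _ _ hV G H h => ?_⟩
  · simp only [xiPoly_eq_aeval, h.UPoly_eq hV]
  · simp only [h.UPoly_eq hV]
  · simp only [xiPoly_eq_aeval, h.UPoly_eq hV]
  · simp only [bivariateChromatic_eq, xiBivariate, xiPoly_eq_aeval, h.UPoly_eq hV]
  · simp only [chromaticSymm_eq, h.UPoly_eq hV]
  · simp only [polychromate_eq, h.UPoly_eq hV]
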